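/- Let $p$ be a prime and let $G$ be a residually finite group with profinite completion $\widehat G$. Assume that $G$ is cohomologically good, i.e. the natural map $G\to\widehat G$ induces isomorphisms $H^n(\widehat G,M)\to H^n(G,M)$ for every $n\ge 0$ and every finite discrete $\widehat G$-module $M$, where $H^n(\widehat G,M)$ denotes continuous cohomology (equivalently, for every finite $G$-module $M$, since the $G$-action on such an $M$ extends uniquely to a continuous action of $\widehat G$). Assume also that $\mathrm{vcd}(G)<\infty$, i.e. $G$ has a torsion-free subgroup of finite index whose cohomological dimension is finite. Then $G$ has finitely many conjugacy classes of subgroups of order $p$ if and only if it has finitely many conjugacy classes of elements of order $p$; and if this is the case, then every element of order $p$ in $\widehat G$ is conjugate in $\widehat G$ to (the image of) some element of $G$. -/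

import Mathlib

open CategoryTheory

universe u

noncomputable section

/-- The ring of integers, in the universe of the groups under consideration: `Rep IntU G` is the
category of `G`-modules (abelian groups with a linear action of `G`). -/
def IntU : Type u := ULift.{u} ℤ

instance : CommRing IntU.{u} := inferInstanceAs (CommRing (ULift.{u} ℤ))

/-- The profinite completion of an abstract group, the inverse limit of its finite quotients. -/
abbrev ProfComp (G : Type u) [Group G] : Type u :=
  ProfiniteGrp.ProfiniteCompletion.completion (GrpCat.of G)

/-- The canonical homomorphism of a group to its profinite completion. -/
def toProfComp (G : Type u) [Group G] : G →* ProfComp G :=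
  (ProfiniteGrp.ProfiniteCompletion.eta (GrpCat.of G)).hom

section ContinuousCochains

variable {k Γ : Type u} [CommRing k] [Group Γ] [TopologicalSpace Γ]

/-- A `k`-linear `Γ`-module `A` is a discrete `Γ`-module if the action `Γ × A → A` is continuous for the
discrete topology on `A`; equivalently, all orbit maps `g ↦ g • a` are locally constant. -/
def IsDiscreteModule (A : Rep.{u} k Γ) : Prop :=
  ∀ a : A, IsLocallyConstant fun g : Γ => A.ρ g a

/-- The cochains `Γⁿ → A` that are continuous for the discrete topology on `A`. -/
def contCochains (A : Rep.{u} k Γ) (n : ℕ) : Submodule k ((Fin n → Γ) → A) where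
  carrier := {f | IsLocallyConstant f}
  add_mem' hf hg := hf.add hg
  zero_mem' := IsLocallyConstant.const 0
  smul_mem' c _ hf := hf.comp (c • ·)

theorem continuous_contractNth [IsTopologicalGroup Γ] {n : ℕ} (j : Fin (n + 1)) :
    Continuous fun g : Fin (n + 1) → Γ => Fin.contractNth j (· * ·) g := by
  refine continuous_pi fun i => ?_
  unfold Fin.contractNth
  split_ifs <;> fun_prop

theorem d_mem_contCochains [IsTopologicalGroup Γ] (A : Rep.{u} k Γ)
    (hA : IsDiscreteModule A) (n : ℕ) (f : (Fin n → Γ) → A) (hf : f ∈ contCochains A n) :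
    (inhomogeneousCochains.d A n).hom f ∈ contCochains A (n + 1) := by
  have hf' : IsLocallyConstant f := hf
  have h1 : IsLocallyConstant fun g : Fin (n + 1) → Γ => A.ρ (g 0) (f fun i => g i.succ) := by
    rw [IsLocallyConstant.iff_eventually_eq]
    intro x
    have ha : IsLocallyConstant fun g : Fin (n + 1) → Γ => f fun i => g i.succ :=
      hf'.comp_continuous (by fun_prop)
    have hb : IsLocallyConstant fun g : Fin (n + 1) → Γ => A.ρ (g 0) (f fun i => x i.succ) :=
      (hA (f fun i => x i.succ)).comp_continuous (by fun_prop)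
    filter_upwards [ha.eventually_eq x, hb.eventually_eq x] with y h h'
    rw [h, h']
  have h2 : ∀ j : Fin (n + 1), (fun g : Fin (n + 1) → Γ =>
      (-1 : k) ^ ((j : ℕ) + 1) • f (Fin.contractNth j (· * ·) g)) ∈
        contCochains A (n + 1) := fun j =>
    (hf'.comp_continuous (continuous_contractNth j)).comp
      ((-1 : k) ^ ((j : ℕ) + 1) • ·)
  have h3 := Submodule.sum_mem _ fun (j : Fin (n + 1)) (_ : j ∈ Finset.univ) => h2 j
  have h4 := (contCochains A (n + 1)).add_mem h1 h3
  convert h4 using 1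
  ext g
  simp [inhomogeneousCochains.d_hom_apply]

variable [IsTopologicalGroup Γ]

/-- The differential of inhomogeneous cochains, restricted to continuous cochains. -/
def contCochainsD (A : Rep.{u} k Γ) (hA : IsDiscreteModule A) (n : ℕ) :
    ModuleCat.of k (contCochains A n) ⟶ ModuleCat.of k (contCochains A (n + 1)) :=
  ModuleCat.ofHom ((inhomogeneousCochains.d A n).hom.restrict (d_mem_contCochains A hA n))

theorem contCochainsD_comp (A : Rep.{u} k Γ) (hA : IsDiscreteModule A) (n : ℕ) :
    contCochainsD A hA n ≫ contCochainsD A hA (n + 1) = 0 := by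
  refine ModuleCat.hom_ext (LinearMap.ext fun f => Subtype.ext ?_)
  exact congrArg (fun φ => φ.hom f.1) (groupCohomology.inhomogeneousCochains.d_comp_d n A)

/-- The complex of continuous inhomogeneous cochains of a topological group `Γ` with values in
a discrete `Γ`-module `A`. -/
def contCochainComplex (A : Rep.{u} k Γ) (hA : IsDiscreteModule A) :
    CochainComplex (ModuleCat.{u} k) ℕ :=
  CochainComplex.of (fun n => ModuleCat.of k (contCochains A n))
    (contCochainsD A hA) (contCochainsD_comp A hA)

/-- The continuous cohomology group `Hⁿ(Γ, A)` of a discrete `Γ`-module `A`. -/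
def contCohomology (A : Rep.{u} k Γ) (hA : IsDiscreteModule A) (n : ℕ) :
    ModuleCat.{u} k :=
  (contCochainComplex A hA).homology n

/-- The inclusion of the complex of continuous cochains in that of all cochains. -/
def contCochainsIncl (A : Rep.{u} k Γ) (hA : IsDiscreteModule A) :
    contCochainComplex A hA ⟶ groupCohomology.inhomogeneousCochains A where
  f n := ModuleCat.ofHom (contCochains A n).subtype
  comm' i j hij := by
    obtain rfl : i + 1 = j := hij
    simp only [contCochainComplex, CochainComplex.of_d]
    rfl

/-- The map `Hⁿ(Γ, A) → Hⁿ(G, A)` induced by a homomorphism `φ : G → Γ` of an abstract group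
to a topological group: a continuous cocycle `c` is sent to `c ∘ φⁿ`. -/
def contCohomologyRes {G : Type u} [Group G] (φ : G →* Γ) (A : Rep.{u} k Γ)
    (hA : IsDiscreteModule A) (n : ℕ) :
    contCohomology A hA n ⟶ groupCohomology (Rep.res φ A) n :=
  HomologicalComplex.homologyMap
    (contCochainsIncl A hA ≫ groupCohomology.cochainsMap φ (𝟙 (Rep.res φ A))) n

end ContinuousCochains

/-- A group `G` is cohomologically good if the canonical map to its profinite completion `Ĝ`
induces isomorphisms `Hⁿ(Ĝ, M) ≅ Hⁿ(G, M)` for all `n` and all finite modules `M`.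
(Every action of `G` on a finite module extends uniquely to a continuous action of `Ĝ`.) -/
def IsCohomologicallyGood (G : Type u) [Group G] : Prop :=
  ∀ (M : Rep.{u} IntU.{u} (ProfComp G)) (hM : IsDiscreteModule M), Finite M →
    ∀ n : ℕ, IsIso (contCohomologyRes (toProfComp G) M hM n)

/-- The cohomological dimension of a group `G`: the projective dimension of the trivial
`G`-module `ℤ`. -/
def cohomDim (G : Type u) [Group G] : WithBot ℕ∞ :=
  projectiveDimension (Rep.trivial IntU.{u} G IntU.{u})

/-- The virtual cohomological dimension of a group: the cohomological dimension of its torsion-free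
subgroups of finite index, or `⊤` if there are none. (By a theorem of Serre these subgroups
all have the same cohomological dimension, so the infimum is their common value.) -/
def vcd (G : Type u) [Group G] : WithBot ℕ∞ :=
  ⨅ (H : Subgroup G) (_ : H.FiniteIndex) (_ : ∀ h : H, IsOfFinOrder h → h = 1), cohomDim H

open scoped Pointwise in
/-- The set of conjugacy classes of subgroups of order `p` of `G`. -/
def subgroupClassesOfOrder (G : Type u) [Group G] (p : ℕ) :
    Set (MulAction.orbitRel.Quotient (ConjAct G) (Subgroup G)) :=
  (fun P : Subgroup G => (Quotient.mk'' P : MulAction.orbitRel.Quotient (ConjAct G) (Subgroup G)))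
    '' {P : Subgroup G | Nat.card P = p}

/-- The set of conjugacy classes of elements of order `p` of `G`. -/
def elementClassesOfOrder (G : Type u) [Group G] (p : ℕ) : Set (ConjClasses G) :=
  ConjClasses.mk '' {g : G | orderOf g = p}

end

noncomputable section

/-! ### Vanishing of group cohomology -/

section CohomologyVanishing

open Limits

variable {k H : Type u} [CommRing k] [Group H]

/-! The equivalence is elementary: a subgroup of order `p` is finite and generated by any nontrivial
element. For the last claim, let `γ` of order `p` in `Ĝ` be conjugate to no element of `G`. By
finiteness, the conjugates of the order `p` elements of `G` form a closed set. So there is an open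
normal `V` such that `γV` misses this set and `1`, while `V ∩ G` lies in a torsion-free subgroup of
finite cohomological dimension. Let `C` be the group of order `p` generated by the image of `γ` in
`Ĝ/V`, let `K` be its preimage in `Ĝ` and `H` its preimage in `G`. Since `γ` splits `K → C`, the
cohomology `Hⁿ(C, 𝔽_p)`, nonzero in positive even degrees, embeds in `Hⁿ(K, 𝔽_p)`, which is `Hⁿ(H,
𝔽_p)` by Shapiro's lemma and goodness. A `p`-local form of Serre's theorem
(`exists_isZero_groupCohomology`) then forces an element of order `p` in `H`. A power of it lies in
`γV` (`exists_orderOf_eq_map_eq`), a contradiction.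

Serre's theorem is proved by tensor induction in dual form. Let `U` be normal in `H` of index `p`
with cohomology vanishing in high degrees, and `X = H/U`. Attach to `M` the representation of
multilinear maps `M^X → W`. For a high syzygy `M` of `k`, the restriction to `U` is a direct summand
of an induced module, so the identity of `M` is a trace. Multilinear expansion then writes the
identity of the multilinear maps as a sum over sections of `H → X`. If `H` has no elements of order
`p`, it acts freely on these sections, so the representation is acyclic
(`isZero_groupCohomology_multilinearRep`). To descend along `0 → A → B → C → 0` from the syzygy `A`
to `C`, multilinear maps on `B^X` are filtered by the number of arguments in `A`. The intermediate
graded pieces involve `j`-subsets of `X` with `0 < j < p`. As `j` is invertible mod `p`, averaging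
reduces their cohomology to that of `U` (`isZero_groupCohomology_gradedPiece`). -/

theorem isZero_groupCohomology_of_retract {A B : Rep.{u} k H} (i : A ⟶ B) (r : B ⟶ A)
    (h : i ≫ r = 𝟙 A) (n : ℕ) (hB : IsZero (groupCohomology B n)) :
    IsZero (groupCohomology A n) := by
  refine (IsZero.iff_id_eq_zero _).2 ?_
  rw [← groupCohomology.map_id, ← h, groupCohomology.map_id_comp,
    hB.eq_of_tgt (groupCohomology.map (MonoidHom.id H) i n) 0, zero_comp]

theorem Rep.shortExact_of_exact {A B C : Rep.{u} k H} (f : A ⟶ B) (g : B ⟶ C)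
    (hf : Function.Injective f.hom) (hg : Function.Surjective g.hom)
    (hfg : Function.Exact f.hom g.hom) :
    ∃ w : f ≫ g = 0, (ShortComplex.mk f g w).ShortExact := by
  have w : f ≫ g = 0 := by
    ext x
    exact (hfg _).2 ⟨x, rfl⟩
  refine ⟨w, ?_⟩
  have hm : Mono f := (Rep.mono_iff_injective f).2 hf
  have he : Epi g := (Rep.epi_iff_surjective g).2 hg
  refine ⟨?_⟩
  rw [← ShortComplex.exact_map_iff_of_faithful _ (forget₂ (Rep.{u} k H) (ModuleCat k)),
    ShortComplex.ShortExact.moduleCat_exact_iff_function_exact]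
  exact hfg

theorem isZero_groupCohomology_left {A B C : Rep.{u} k H} (f : A ⟶ B) (g : B ⟶ C)
    (hf : Function.Injective f.hom) (hg : Function.Surjective g.hom)
    (hfg : Function.Exact f.hom g.hom) (n : ℕ) (hC : IsZero (groupCohomology C n))
    (hB : IsZero (groupCohomology B (n + 1))) : IsZero (groupCohomology A (n + 1)) := by
  obtain ⟨w, hX⟩ := Rep.shortExact_of_exact f g hf hg hfg
  exact (groupCohomology.mapShortComplex₁_exact hX rfl).isZero_of_both_zeros
    (hC.eq_of_src _ _) (hB.eq_of_tgt _ _)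

theorem isZero_groupCohomology_right {A B C : Rep.{u} k H} (f : A ⟶ B) (g : B ⟶ C)
    (hf : Function.Injective f.hom) (hg : Function.Surjective g.hom)
    (hfg : Function.Exact f.hom g.hom) (n : ℕ) (hB : IsZero (groupCohomology B n))
    (hA : IsZero (groupCohomology A (n + 1))) : IsZero (groupCohomology C n) := by
  obtain ⟨w, hX⟩ := Rep.shortExact_of_exact f g hf hg hfg
  exact (groupCohomology.mapShortComplex₃_exact hX rfl).isZero_of_both_zeros
    (hB.eq_of_src _ _) (hA.eq_of_tgt _ _)

/-- A group has cohomology vanishing from degree `N` on. -/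
def CohomologyVanishesFrom (k H : Type u) [CommRing k] [Group H] (N : ℕ) : Prop :=
  ∀ (W : Rep.{u} k H) (n : ℕ), N ≤ n → IsZero (groupCohomology W n)

/-- A cocycle on the bar resolution represents an `Ext` class, which is zero from degree `N` on. The
bound `N + 1` keeps the degree positive, so that there is a preceding bar term through which the
cocycle can factor. -/
theorem cohomologyVanishesFrom_of_hasProjectiveDimensionLT {N : ℕ}
    (h : HasProjectiveDimensionLT (Rep.trivial k H k) N) : CohomologyVanishesFrom k H (N + 1) := by
  intro W n hn
  obtain ⟨m, rfl⟩ : ∃ m, n = m + 1 := ⟨n - 1, by omega⟩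
  let P := Rep.barResolution k H
  refine IsZero.of_iso ?_ (groupCohomologyIso W (m + 1) P)
  rw [← HomologicalComplex.exactAt_iff_isZero_homology]
  have hE := HasExt.standard (Rep.{u} k H)
  rw [HomologicalComplex.exactAt_iff' _ m (m + 1) (m + 2) (by simp) (by simp),
    ShortComplex.moduleCat_exact_iff]
  intro (f : P.complex.X (m + 1) ⟶ W) hf
  have hf' : P.complex.d (m + 2) (m + 1) ≫ f = 0 := hf
  obtain ⟨g, hg⟩ := (P.extMk_eq_zero_iff f (m + 2) rfl hf' m rfl).1
    (Abelian.Ext.eq_zero_of_hasProjectiveDimensionLT _ N (by omega))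
  exact ⟨g, hg⟩

theorem CohomologyVanishesFrom.subgroup {N : ℕ} (h : CohomologyVanishesFrom k H N)
    (S : Subgroup H) : CohomologyVanishesFrom k S N := fun W n hn =>
  (h (Rep.coind S.subtype W) n hn).of_iso (groupCohomology.coindIso W n).symm

theorem CohomologyVanishesFrom.of_mulEquiv {N : ℕ} (h : CohomologyVanishesFrom k H N)
    {K : Type u} [Group K] (e : K ≃* H) : CohomologyVanishesFrom k K N := by
  intro W n hn
  let W' : Rep.{u} k H := Rep.res e.symm.toMonoidHom W
  have he : ∀ g : K, (LinearEquiv.refl k W).toLinearMap ∘ₗ W.ρ g =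
      W'.ρ (e g) ∘ₗ (LinearEquiv.refl k W).toLinearMap := fun g => by
    ext; simp [W']
  exact (h W' n hn).of_iso (groupCohomology.mapIso (A := W') e (LinearEquiv.refl k W) he n)

theorem CohomologyVanishesFrom.of_injective {N : ℕ} (h : CohomologyVanishesFrom k H N)
    {K : Type u} [Group K] (f : K →* H) (hf : Function.Injective f) :
    CohomologyVanishesFrom k K N :=
  (h.subgroup f.range).of_mulEquiv (MonoidHom.ofInjective hf)

end CohomologyVanishing

/-! ### Retracts of coinduced modules and traces -/

section Averaging

open Limits

variable {k H : Type u} [CommRing k] [Group H]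

/-- A representation which is a retract of the representation coinduced from its restriction to `S`,
by means of the retraction `r`, inherits the vanishing of the cohomology of `S`. -/
theorem isZero_groupCohomology_of_coind_retraction (S : Subgroup H) (E : Rep.{u} k H)
    (r : Representation.coindV S.subtype (Rep.res S.subtype E).ρ →ₗ[k] E)
    (hr : ∀ h φ, r (Representation.coind S.subtype (Rep.res S.subtype E).ρ h φ) = E.ρ h (r φ))
    (hi : ∀ v, r ⟨fun x => E.ρ x v, fun g h => by simp⟩ = v) (n : ℕ)
    (hE : IsZero (groupCohomology (Rep.res S.subtype E) n)) :
    IsZero (groupCohomology E n) := by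
  let i : E ⟶ Rep.coind S.subtype (Rep.res S.subtype E) := Rep.ofHom
    { toFun v := ⟨fun x => E.ρ x v, fun g h => by simp⟩
      map_add' v w := by ext; simp
      map_smul' c v := by ext; simp
      isIntertwining' h := by
        ext v x
        exact (congrArg (fun f : E →ₗ[k] E => f v) (map_mul E.ρ x h)).symm }
  let r' : Rep.coind S.subtype (Rep.res S.subtype E) ⟶ E := Rep.ofHom
    { r with isIntertwining' h := by ext φ; exact hr h φ }
  refine isZero_groupCohomology_of_retract i r' ?_ n
    (hE.of_iso (groupCohomology.coindIso (Rep.res S.subtype E) n))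
  ext v
  exact hi v

theorem isZero_groupCohomology_succ_of_retraction (E : Rep.{u} k H) (r : (H → E) →ₗ[k] E)
    (hr : ∀ h φ, r (fun x => φ (x * h)) = E.ρ h (r φ))
    (hi : ∀ v, r (fun x => E.ρ x v) = v) (n : ℕ) :
    IsZero (groupCohomology E (n + 1)) :=
  isZero_groupCohomology_of_coind_retraction ⊥ E (r ∘ₗ Submodule.subtype _)
    (fun h φ => hr h φ.1) hi _ (isZero_groupCohomology_succ_of_subsingleton _ _)

/-- If the identity of `E` is the trace from a subgroup `U` of finite index of a `U`-equivariant
endomorphism `e`, then `E` inherits the vanishing of the cohomology of `U`. -/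
theorem isZero_groupCohomology_of_trace (U : Subgroup H) [Fintype (H ⧸ U)] (E : Rep.{u} k H)
    (e : E →ₗ[k] E) (he : ∀ u ∈ U, ∀ v, e (E.ρ u v) = E.ρ u (e v))
    (hsum : ∀ v, ∑ c : H ⧸ U, E.ρ c.out (e (E.ρ c.out⁻¹ v)) = v) (n : ℕ)
    (hE : IsZero (groupCohomology (Rep.res U.subtype E) n)) :
    IsZero (groupCohomology E n) := by
  -- The summand depends only on the coset, as `φ` transforms under `U` and `e` commutes with `U`;
  -- coset representatives may thus be changed.
  have key : ∀ (φ : Representation.coindV U.subtype (Rep.res U.subtype E).ρ) (a b : H),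
      (a : H ⧸ U) = b → E.ρ a (e (φ.1 a⁻¹)) = E.ρ b (e (φ.1 b⁻¹)) := by
    intro φ a b hab
    have hu : a⁻¹ * b ∈ U := QuotientGroup.eq.1 hab
    have h1 := φ.2 ⟨a⁻¹ * b, hu⟩ b⁻¹
    simp only [Subgroup.subtype_apply, mul_assoc, mul_inv_cancel, mul_one, Rep.res_obj_ρ,
      MonoidHom.comp_apply] at h1
    rw [h1, he _ hu, ← Module.End.mul_apply, ← map_mul, mul_inv_cancel_left]
  refine isZero_groupCohomology_of_coind_retraction U E
    { toFun φ := ∑ c : H ⧸ U, E.ρ c.out (e (φ.1 c.out⁻¹))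
      map_add' φ ψ := by simp [Finset.sum_add_distrib]
      map_smul' a φ := by simp [Finset.smul_sum] } ?_ hsum n hE
  intro h φ
  simp only [LinearMap.coe_mk, AddHom.coe_mk, map_sum]
  refine Fintype.sum_equiv (MulAction.toPerm h⁻¹) _ _ fun c => ?_
  have hc : ((h⁻¹ * c.out : H) : H ⧸ U) = ((MulAction.toPerm h⁻¹ c : H ⧸ U).out : H) := by
    rw [QuotientGroup.out_eq', MulAction.toPerm_apply, ← smul_eq_mul, MulAction.Quotient.coe_smul_out]
  rw [← key φ _ _ hc, map_mul, Module.End.mul_apply, ← Module.End.mul_apply (E.ρ h), ← map_mul,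
    mul_inv_cancel, map_one, Module.End.one_apply]
  congr 2
  change φ.1 (c.out⁻¹ * h) = _
  simp

end Averaging

/-! ### Tensor induction in dual form -/

section Multilinear

open Limits

variable {k H : Type u} [CommRing k] [Group H] (X : Type u) [MulAction H X]

variable (M N : Rep.{u} k H)

/-- The action of `H` on the multilinear maps from `X`-indexed families of elements of `M` to `N`;
the group acts on `M`, on `N`, and by permuting `X`. -/
def multilinearAction : Representation k H (MultilinearMap k (fun _ : X => M) N) where
  toFun h :=
    { toFun f := (N.ρ h).compMultilinearMap
        ((f.domDomCongr (MulAction.toPerm h)).compLinearMap fun _ => M.ρ h⁻¹)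
      map_add' f g := by ext; simp
      map_smul' c f := by ext; simp }
  map_one' := by ext f m; simp [MulAction.toPerm_one]
  map_mul' g h := by ext f m; simp [mul_smul, MulAction.toPerm]

/-- The representation of `H` on multilinear maps given by `multilinearAction`. -/
abbrev multilinearRep : Rep.{u} k H := Rep.of (multilinearAction X M N)

variable {X M N}

theorem multilinearAction_apply (h : H) (f : MultilinearMap k (fun _ : X => M) N) (m : X → M) :
    multilinearAction X M N h f m = N.ρ h (f fun x => M.ρ h⁻¹ (m (h • x))) := rfl

end Multilinear

/-! ### Acyclicity from a free action on orbit sections -/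

section Trace

open Limits

variable {k H : Type u} [CommRing k] [Group H] {X : Type u} [MulAction H X]

/-- The conjugate by `h` of a linear endomorphism of a representation. -/
def conjEnd (M : Rep.{u} k H) (e : M →ₗ[k] M) (h : H) : M →ₗ[k] M := M.ρ h ∘ₗ e ∘ₗ M.ρ h⁻¹

theorem conjEnd_ρ (M : Rep.{u} k H) (e : M →ₗ[k] M) (g h : H) (m : M) :
    conjEnd M e h (M.ρ g⁻¹ m) = M.ρ g⁻¹ (conjEnd M e (g * h) m) := by
  simp [conjEnd]

/-- The identity of `M` is, for every `x`, the pointwise finite sum of the conjugates of `e` by the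
elements that carry the point `x₀` to `x`. -/
def IsTraceOne (x₀ : X) (M : Rep.{u} k H) (e : M →ₗ[k] M) : Prop :=
  ∀ (x : X) (m : M), ∃ A : Finset H, (∀ h ∈ A, h • x₀ = x) ∧
    (∀ h, h • x₀ = x → h ∉ A → conjEnd M e h m = 0) ∧ ∑ h ∈ A, conjEnd M e h m = m

/-- The sections of the orbit map `H → X`, `h ↦ h • x₀`. -/
abbrev OrbitSection (H : Type u) [Group H] {X : Type u} [MulAction H X] (x₀ : X) : Type u :=
  {y : X → H // ∀ x, y x • x₀ = x}

instance (x₀ : X) : MulAction H (OrbitSection H x₀) where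
  smul h y := ⟨fun x => h * y.1 (h⁻¹ • x), fun x => by rw [mul_smul, y.2, smul_inv_smul]⟩
  one_smul y := Subtype.ext <| funext fun x => by
    change 1 * y.1 ((1 : H)⁻¹ • x) = _
    simp
  mul_smul g h y := Subtype.ext <| funext fun x => by
    change g * h * y.1 ((g * h)⁻¹ • x) = g * (h * y.1 (h⁻¹ • g⁻¹ • x))
    simp [mul_smul, mul_assoc]

theorem OrbitSection.smul_apply (x₀ : X) (h : H) (y : OrbitSection H x₀) (x : X) :
    (h • y).1 x = h * y.1 (h⁻¹ • x) := rfl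

/-- With a base point chosen in each orbit, `η y` is the unique element that carries `y` to the base
point. -/
theorem exists_equivariant_of_free {Y : Type*} [MulAction H Y]
    (hfree : ∀ (h : H) (y : Y), h • y = y → h = 1) :
    ∃ η : Y → H, ∀ h y, η (h • y) = η y * h⁻¹ := by
  let q : Y → Y := fun y => (Quotient.mk (MulAction.orbitRel H Y) y).out
  have hq : ∀ y, ∃ g : H, g • y = q y := fun y => by
    have := Quotient.mk_out (s := MulAction.orbitRel H Y) y
    exact MulAction.mem_orbit_iff.1 (MulAction.orbitRel_apply.1 this)
  choose η hη using hq
  refine ⟨η, fun h y => ?_⟩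
  have hqq : q (h • y) = q y := by
    have : Quotient.mk (MulAction.orbitRel H Y) (h • y) = Quotient.mk _ y :=
      Quotient.sound (MulAction.orbitRel_apply.2 (MulAction.mem_orbit y h))
    simp only [q, this]
  have := hfree (η (h • y) * h * (η y)⁻¹) (q y) (by
    rw [mul_smul, mul_smul, ← hη y, inv_smul_smul, hη y, ← hqq, hη])
  rw [mul_inv_eq_one] at this
  rw [← this, mul_inv_cancel_right]

/-- The sum of a pointwise finite family of multilinear maps. -/
def MultilinearMap.finsum {X Y : Type*} {M N : Type*} [AddCommGroup M] [Module k M]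
    [AddCommGroup N] [Module k N] (L : Y → MultilinearMap k (fun _ : X => M) N)
    (hL : ∀ m, (Function.support fun y => L y m).Finite) :
    MultilinearMap k (fun _ : X => M) N where
  toFun m := ∑ᶠ y, L y m
  map_update_add' m i a b := by
    rw [← finsum_add_distrib (hL _) (hL _)]
    simp
  map_update_smul' m i c a := by
    rw [smul_finsum' c (hL _)]
    simp

variable {x₀ : X} {M N : Rep.{u} k H} {e : M →ₗ[k] M}

theorem IsTraceOne.finite_support [Finite X] (he : IsTraceOne x₀ M e)
    (L : OrbitSection H x₀ → MultilinearMap k (fun _ : X => M) N) (m : X → M) :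
    (Function.support fun y => (L y).compLinearMap (fun x => conjEnd M e (y.1 x)) m).Finite := by
  choose A hA hA' hA'' using he
  refine Set.Finite.subset (Set.Finite.preimage Subtype.val_injective.injOn
    (Set.Finite.pi (fun x => (A x (m x)).finite_toSet))) fun y hy x _ => ?_
  by_contra hx
  exact hy ((L y).map_coord_zero x (hA' x (m x) (y.1 x) (y.2 x) hx))

/-- Each argument `m x` is expanded as a sum over elements of `H` above `x`. Choosing one summand
for every `x` amounts to choosing a section of the orbit map. -/
theorem IsTraceOne.finsum_eq [Finite X] (he : IsTraceOne x₀ M e)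
    (f : MultilinearMap k (fun _ : X => M) N) (m : X → M) :
    ∑ᶠ y : OrbitSection H x₀, f.compLinearMap (fun x => conjEnd M e (y.1 x)) m = f m := by
  classical
  have := Fintype.ofFinite X
  choose A hA hA' hA'' using he
  let s := Fintype.piFinset fun x => A x (m x)
  let F : (X → H) → N := fun y => f fun x => conjEnd M e (y x) (m x)
  have h1 : f m = ∑ y ∈ s, F y := by
    conv_lhs => rw [← funext fun x => hA'' x (m x)]
    rw [f.map_sum_finset]
  rw [h1, ← Finset.sum_subtype_of_mem F (p := fun y => ∀ x, y x • x₀ = x)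
    (fun y hy x => hA x _ _ (Fintype.mem_piFinset.1 hy x))]
  refine finsum_eq_sum_of_support_subset _ fun y hy => ?_
  rw [Finset.mem_coe, Finset.mem_subtype, Fintype.mem_piFinset]
  intro x
  by_contra hx
  exact hy (f.map_coord_zero x (hA' x (m x) (y.1 x) (y.2 x) hx))

/-- The identity is a sum over sections, which form a free `H`-set. Letting the section `y` read off
the coordinate `η y` makes this sum a retraction from the module coinduced from the trivial
subgroup. -/
theorem isZero_groupCohomology_multilinearRep [Finite X] (he : IsTraceOne x₀ M e)
    (hfree : ∀ (h : H) (y : OrbitSection H x₀), h • y = y → h = 1) (n : ℕ) :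
    IsZero (groupCohomology (multilinearRep X M N) (n + 1)) := by
  obtain ⟨η, hη⟩ := exists_equivariant_of_free hfree
  let L (φ : H → MultilinearMap k (fun _ : X => M) N) (y : OrbitSection H x₀) :
      MultilinearMap k (fun _ : X => M) N :=
    (multilinearAction X M N (η y)⁻¹ (φ (η y))).compLinearMap fun x => conjEnd M e (y.1 x)
  have hL (φ) (m) : (Function.support fun y => L φ y m).Finite := he.finite_support _ m
  have hL_add (φ ψ) (y) (m) : L (φ + ψ) y m = L φ y m + L ψ y m := by simp [L]
  have hL_smul (c : k) (φ) (y) (m) : L (c • φ) y m = c • L φ y m := by simp [L]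
  let r : (H → MultilinearMap k (fun _ : X => M) N) →ₗ[k] MultilinearMap k (fun _ : X => M) N :=
    { toFun φ := MultilinearMap.finsum (L φ) (hL φ)
      map_add' φ ψ := MultilinearMap.ext fun m =>
        (finsum_congr fun y => hL_add φ ψ y m).trans (finsum_add_distrib (hL φ m) (hL ψ m))
      map_smul' c φ := MultilinearMap.ext fun m =>
        (finsum_congr fun y => hL_smul c φ y m).trans (smul_finsum' c (hL φ m)).symm }
  refine isZero_groupCohomology_succ_of_retraction (multilinearRep X M N) r ?_ ?_ n
  · intro h φ
    ext m
    change ∑ᶠ y, L (fun x => φ (x * h)) y m = N.ρ h (∑ᶠ y, L φ y fun x => M.ρ h⁻¹ (m (h • x)))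
    rw [map_finsum _ (hL φ _)]
    refine finsum_eq_of_bijective (h⁻¹ • ·) (MulAction.bijective h⁻¹) fun y => ?_
    simp only [L, MultilinearMap.compLinearMap_apply, multilinearAction_apply, conjEnd_ρ,
      OrbitSection.smul_apply, hη]
    have hx (x : X) : h • (η y * h⁻¹⁻¹)⁻¹ • x = (η y)⁻¹ • x := by
      rw [smul_smul]
      congr 1
      group
    simp [mul_smul]
    refine congrArg _ (congrArg _ (funext fun x => ?_))
    exact congrArg (fun z => M.ρ (η y) (conjEnd M e (y.1 ((η y)⁻¹ • x)) (m z))) (hx x).symm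
  · intro f
    ext m
    refine Eq.trans (finsum_congr fun y => ?_) (he.finsum_eq f m)
    simp only [L]
    rw [← Module.End.mul_apply, ← map_mul]
    simp

end Trace

/-! ### The filtration of multilinear maps on an extension -/

section Filtration

open Limits

variable {k H : Type u} [CommRing k] [Group H] {A B C N : Rep.{u} k H}

/-- A splitting of `A ⟶ B ⟶ C` as a sequence of `k`-modules. -/
structure LinearSplitting (f : A ⟶ B) (g : B ⟶ C) where
  /-- the linear retraction of `f` -/
  retr : B →ₗ[k] A
  /-- the linear section of `g` -/
  sect : C →ₗ[k] B
  retr_apply : ∀ a, retr (f.hom a) = a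
  apply_sect : ∀ c, g.hom (sect c) = c
  apply_apply : ∀ a, g.hom (f.hom a) = 0
  add_eq : ∀ b, f.hom (retr b) + sect (g.hom b) = b

variable {f : A ⟶ B} {g : B ⟶ C} {X : Type u} [Fintype X]

theorem LinearSplitting.apply_retr_of_eq_zero (s : LinearSplitting f g) {b : B} (hb : g.hom b = 0) :
    f.hom (s.retr b) = b := by
  simpa [hb] using s.add_eq b

open scoped Classical in
/-- The set of coordinates of a family `b` that are killed by `g`. -/
def zeroCoords (g : B ⟶ C) (b : X → B) : Finset X := Finset.univ.filter fun x => g.hom (b x) = 0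

theorem mem_zeroCoords {b : X → B} {x : X} : x ∈ zeroCoords g b ↔ g.hom (b x) = 0 := by
  simp [zeroCoords]

variable (N X) in
/-- The multilinear maps that vanish as soon as `j` of the arguments are killed by `g`. -/
def vanishing (g : B ⟶ C) (j : ℕ) : Submodule k (MultilinearMap k (fun _ : X => B) N) where
  carrier := {φ | ∀ b, j ≤ (zeroCoords g b).card → φ b = 0}
  add_mem' hφ hψ b hb := by simp [hφ b hb, hψ b hb]
  zero_mem' b _ := rfl
  smul_mem' c φ hφ b hb := by simp [hφ b hb]

theorem vanishing_mono {i j : ℕ} (hij : i ≤ j) : vanishing N X g i ≤ vanishing N X g j :=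
  fun _ hφ b hb => hφ b (hij.trans hb)

/-- Outside `S` the component of an argument in `A` can be dropped: it would be one more argument
killed by `g`, beyond the `j` in `S`. -/
theorem apply_eq_apply_piecewise [DecidableEq X] (s : LinearSplitting f g) {j : ℕ}
    {φ : MultilinearMap k (fun _ : X => B) N} (hφ : φ ∈ vanishing N X g (j + 1)) {S : Finset X}
    (hS : S.card = j) {b : X → B} (hb : ∀ x ∈ S, g.hom (b x) = 0) :
    φ b = φ (S.piecewise b fun x => s.sect (g.hom (b x))) := by
  set m := S.piecewise b fun x => s.sect (g.hom (b x)) with hm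
  set m' := S.piecewise (0 : X → B) fun x => f.hom (s.retr (b x)) with hm'
  have hbm : b = m + m' := by
    ext x
    by_cases hx : x ∈ S
    · simp [hm, hm', hx]
    · simp only [hm, hm', hx, Pi.add_apply, Finset.piecewise_eq_of_notMem, not_false_eq_true]
      exact (s.add_eq (b x)).symm.trans (add_comm _ _)
  -- Here `t` is the set of coordinates taken from `m`. A proper `t` containing `S` leaves at least
  -- `j + 1` killed arguments; a `t` missing a point of `S` leaves a zero argument.
  rw [hbm, φ.map_add_univ, Finset.sum_eq_single Finset.univ]
  · simp
  · intro t _ ht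
    by_cases hSt : S ⊆ t
    · refine hφ _ ?_
      obtain ⟨y, hy⟩ : ∃ y, y ∉ t := by simpa [Finset.eq_univ_iff_forall] using ht
      have hyS : y ∉ S := fun h => hy (hSt h)
      rw [← hS, ← Finset.card_insert_of_notMem hyS]
      refine Finset.card_le_card fun x hx => ?_
      rw [mem_zeroCoords]
      rcases Finset.mem_insert.1 hx with rfl | hx
      · simp [hm', hy, hyS, s.apply_apply]
      · simp [hSt hx, hm, hx, hb]
    · obtain ⟨y, hyS, hy⟩ := Finset.not_subset.1 hSt
      exact φ.map_coord_zero y (by simp [hy, hm', hyS])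
  · simp

/-- The sum of the components of `φ` of type `S`, with weight `w S`, where `S` runs through the sets
of `j` coordinates, and an argument of type `S` has its coordinates in `S` in `A` and the others
in `C`. -/
def weightedComponents [DecidableEq X] (s : LinearSplitting f g) (w : Finset X → k) (j : ℕ) :
    MultilinearMap k (fun _ : X => B) N →ₗ[k] MultilinearMap k (fun _ : X => B) N :=
  ∑ S ∈ Finset.powersetCard j Finset.univ, w S • MultilinearMap.compLinearMapₗ
    fun x => if x ∈ S then f.hom.toLinearMap ∘ₗ s.retr else s.sect ∘ₗ g.hom.toLinearMap

/-- A set `S` other than the set `Z` of killed coordinates misses a point of `Z`, where its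
component has a zero argument. So only `S = Z` contributes; if `Z` has more than `j` points, both
sides vanish. -/
theorem weightedComponents_apply [DecidableEq X] (s : LinearSplitting f g) (w : Finset X → k)
    {j : ℕ} {φ : MultilinearMap k (fun _ : X => B) N} (hφ : φ ∈ vanishing N X g (j + 1))
    {b : X → B} (hb : j ≤ (zeroCoords g b).card) :
    weightedComponents s w j φ b = w (zeroCoords g b) • φ b := by
  set Z := zeroCoords g b with hZ
  simp only [weightedComponents, LinearMap.sum_apply, sum_apply,
    LinearMap.smul_apply, smul_apply, MultilinearMap.compLinearMapₗ_apply,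
    MultilinearMap.compLinearMap_apply]
  have hne {S : Finset X} (hS : S ∈ Finset.powersetCard j Finset.univ) (hSZ : S ≠ Z) :
      (φ fun x => (if x ∈ S then f.hom.toLinearMap ∘ₗ s.retr else s.sect ∘ₗ g.hom.toLinearMap)
        (b x)) = 0 := by
    have hS' := (Finset.mem_powersetCard.1 hS).2
    obtain ⟨x, hxZ, hxS⟩ : ∃ x ∈ Z, x ∉ S := by
      by_contra! hcon
      exact hSZ (Finset.eq_of_subset_of_card_le hcon (hS'.trans_le hb)).symm
    refine φ.map_coord_zero x ?_
    have hx : g.hom (b x) = 0 := mem_zeroCoords.1 hxZ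
    simp [hxS, hx]
  by_cases hj : Z.card = j
  · rw [Finset.sum_eq_single Z (fun S hS hSZ => by rw [hne hS hSZ, smul_zero])
      (fun hZ' => (hZ' (Finset.mem_powersetCard.2 ⟨Finset.subset_univ _, hj⟩)).elim)]
    congr 1
    rw [apply_eq_apply_piecewise s hφ hj (b := b) fun x hx => mem_zeroCoords.1 hx]
    refine congrArg φ (funext fun x => ?_)
    by_cases hx : x ∈ Z
    · simp [hx, s.apply_retr_of_eq_zero (mem_zeroCoords.1 hx)]
    · simp [hx]
  · rw [hφ b (lt_of_le_of_ne hb (Ne.symm hj)), smul_zero]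
    refine Finset.sum_eq_zero fun S hS => ?_
    rw [hne hS, smul_zero]
    rintro rfl
    exact hj (Finset.mem_powersetCard.1 hS).2

variable [MulAction H X]

theorem mem_zeroCoords_smul (h : H) (b : X → B) (x : X) :
    x ∈ zeroCoords g (fun x => B.ρ h⁻¹ (b (h • x))) ↔ h • x ∈ zeroCoords g b := by
  rw [mem_zeroCoords, mem_zeroCoords, Rep.hom_comm_apply]
  exact map_eq_zero_iff _ (C.ρ.apply_bijective h⁻¹).injective

theorem card_zeroCoords_smul (h : H) (b : X → B) :
    (zeroCoords g fun x => B.ρ h⁻¹ (b (h • x))).card = (zeroCoords g b).card := by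
  refine Finset.card_bij (fun x _ => h • x) (fun x hx => (mem_zeroCoords_smul h b x).1 hx)
    (fun x _ y _ hxy => MulAction.injective h hxy) fun x hx => ⟨h⁻¹ • x, ?_, smul_inv_smul h x⟩
  rw [mem_zeroCoords_smul, smul_inv_smul]
  exact hx

theorem vanishing_le_comap (j : ℕ) (h : H) :
    vanishing N X g j ≤ (vanishing N X g j).comap (multilinearAction X B N h) := by
  intro φ hφ b hb
  rw [multilinearAction_apply, hφ _ (by rwa [card_zeroCoords_smul]), map_zero]

variable (N X) in
/-- The subrepresentation `vanishing` of the representation on multilinear maps. -/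
abbrev vanishingRep (g : B ⟶ C) (j : ℕ) : Rep.{u} k H :=
  Rep.subrepresentation (multilinearRep X B N) (vanishing N X g j) (vanishing_le_comap j)

variable (N X) in
/-- Precomposition with `f` on multilinear maps. -/
def multilinearRes (f : A ⟶ B) : multilinearRep X B N ⟶ multilinearRep X A N := Rep.ofHom
  { MultilinearMap.compLinearMapₗ (fun _ : X => f.hom.toLinearMap) with
    isIntertwining' h := by
      ext φ a
      refine congrArg (N.ρ h) (congrArg φ (funext fun x => ?_))
      exact (Rep.hom_comm_apply f _ _).symm }

theorem multilinearRes_surjective {X : Type u} [MulAction H X] (s : LinearSplitting f g) :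
    Function.Surjective (multilinearRes N X f).hom := fun φ => by
  refine ⟨(φ : MultilinearMap k (fun _ : X => A) N).compLinearMap fun _ => s.retr, ?_⟩
  ext a
  exact congrArg φ (funext fun x => s.retr_apply _)

theorem exact_subtype_multilinearRes (s : LinearSplitting f g) :
    Function.Exact (Rep.subtype (multilinearRep X B N) (vanishing N X g (Fintype.card X))
      (vanishing_le_comap _)).hom (multilinearRes N X f).hom := fun φ => by
  constructor
  · intro hφ
    refine ⟨⟨φ, fun b hb => ?_⟩, rfl⟩
    have hb' (x : X) : g.hom (b x) = 0 := by
      rw [← mem_zeroCoords (g := g) (b := b),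
        Finset.card_eq_iff_eq_univ _ |>.1 (le_antisymm (Finset.card_le_univ _) hb)]
      exact Finset.mem_univ x
    rw [← funext fun x => s.apply_retr_of_eq_zero (hb' x)]
    exact congrArg (fun ψ : MultilinearMap k (fun _ : X => A) N => ψ fun x => s.retr (b x)) hφ
  · rintro ⟨φ, rfl⟩
    ext a
    refine φ.2 _ ?_
    rw [← Finset.card_univ]
    exact Finset.card_le_card fun x _ => mem_zeroCoords.2 (s.apply_apply _)

theorem isZero_groupCohomology_vanishingRep_card (s : LinearSplitting f g) (n : ℕ)
    (hA : IsZero (groupCohomology (multilinearRep X A N) n))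
    (hB : IsZero (groupCohomology (multilinearRep X B N) (n + 1))) :
    IsZero (groupCohomology (vanishingRep N X g (Fintype.card X)) (n + 1)) :=
  isZero_groupCohomology_left _ _ Subtype.val_injective (multilinearRes_surjective s)
    (exact_subtype_multilinearRes s) n hA hB

theorem isZero_groupCohomology_multilinearRep_left (s : LinearSplitting f g) (n : ℕ)
    (hB : IsZero (groupCohomology (multilinearRep X B N) n))
    (h : IsZero (groupCohomology (vanishingRep N X g (Fintype.card X)) (n + 1))) :
    IsZero (groupCohomology (multilinearRep X A N) n) :=
  isZero_groupCohomology_right _ _ Subtype.val_injective (multilinearRes_surjective s)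
    (exact_subtype_multilinearRes s) n hB h

theorem apply_comp_mem_vanishing_one (φ : MultilinearMap k (fun _ : X => C) N) :
    (multilinearRes N X g).hom φ ∈ vanishing N X g 1 := by
  intro b hb
  obtain ⟨x, hx⟩ := Finset.card_pos.1 hb
  exact φ.map_coord_zero x (mem_zeroCoords.1 hx)

/-- The multilinear maps that vanish as soon as one argument is killed by `g` are those that factor
through `g`. -/
def vanishingRepOneIso (s : LinearSplitting f g) : multilinearRep X C N ≅ vanishingRep N X g 1 where
  hom := Rep.ofHom
    { LinearMap.codRestrict (vanishing N X g 1) (multilinearRes N X g).hom.toLinearMap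
        apply_comp_mem_vanishing_one with
      isIntertwining' h := by
        ext φ b
        refine congrArg (N.ρ h) (congrArg φ (funext fun x => ?_))
        exact (Rep.hom_comm_apply g _ _).symm }
  inv := Rep.ofHom
    { MultilinearMap.compLinearMapₗ (fun _ : X => s.sect) ∘ₗ Submodule.subtype _ with
      isIntertwining' h := by
        classical
        ext φ c
        refine congrArg (N.ρ h) ?_
        refine (apply_eq_apply_piecewise s φ.2 (S := ∅) rfl (by simp)).trans ?_
        refine congrArg φ.1 (funext fun x => ?_)
        rw [Finset.piecewise_empty]
        refine congrArg s.sect ((Rep.hom_comm_apply g h⁻¹ _).trans ?_)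
        exact congrArg (C.ρ h⁻¹) (s.apply_sect (c (h • x))) }
  hom_inv_id := by
    ext φ c
    exact congrArg φ (funext fun x => s.apply_sect _)
  inv_hom_id := by
    classical
    ext φ b
    refine Eq.trans ?_ (apply_eq_apply_piecewise s φ.2 (S := ∅) rfl (by simp)).symm
    rw [Finset.piecewise_empty]
    rfl

end Filtration

/-! ### Cohomology of the graded pieces -/

section GradedPieces

open Limits

variable {k H : Type u} [CommRing k] [Group H] {A B C N : Rep.{u} k H} {f : A ⟶ B} {g : B ⟶ C}
  {U : Subgroup H} [Fintype (H ⧸ U)]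

variable (N U) in
/-- The graded piece of degree `j` of the filtration by the subrepresentations `vanishingRep`. -/
abbrev gradedPiece (g : B ⟶ C) (j : ℕ) : Rep.{u} k H :=
  Rep.quotient (vanishingRep N (H ⧸ U) g (j + 1))
    ((vanishing N (H ⧸ U) g j).submoduleOf (vanishing N (H ⧸ U) g (j + 1)))
    fun h _ hφ => vanishing_le_comap j h hφ

theorem isZero_groupCohomology_vanishingRep (j n : ℕ)
    (hQ : IsZero (groupCohomology (gradedPiece N U g j) n))
    (h : IsZero (groupCohomology (vanishingRep N (H ⧸ U) g (j + 1)) (n + 1))) :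
    IsZero (groupCohomology (vanishingRep N (H ⧸ U) g j) (n + 1)) := by
  let i : vanishingRep N (H ⧸ U) g j ⟶ vanishingRep N (H ⧸ U) g (j + 1) := Rep.ofHom
    { Submodule.inclusion (vanishing_mono j.le_succ) with
      isIntertwining' h := by ext; rfl }
  refine isZero_groupCohomology_left i (Rep.mkQ _ _ _) (fun φ ψ hφψ => ?_)
    (Submodule.mkQ_surjective _) (fun φ => ?_) n hQ h
  · exact Submodule.inclusion_injective (vanishing_mono j.le_succ) hφψ
  · refine (Submodule.Quotient.mk_eq_zero _).trans ⟨fun hφ => ⟨⟨φ.1, hφ⟩, rfl⟩, ?_⟩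
    rintro ⟨ψ, rfl⟩
    exact ψ.2

/-- The operator `e` keeps, with weight `a`, the components whose type `S` contains the base coset.
It commutes with `U` on the graded piece, and its translates over `H ⧸ U` count each `S` once for
each of its `j` points, with total weight `a * j`, which acts as `1`. -/
theorem isZero_groupCohomology_gradedPiece (s : LinearSplitting f g) (j n : ℕ) (a : k)
    (ha : ∀ v : N, (a * j) • v = v)
    (hU : IsZero (groupCohomology (Rep.res U.subtype (gradedPiece N U g j)) n)) :
    IsZero (groupCohomology (gradedPiece N U g j) n) := by
  classical
  let x₀ : H ⧸ U := ((1 : H) : H ⧸ U)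
  let w : Finset (H ⧸ U) → k := fun S => if x₀ ∈ S then a else 0
  let e := weightedComponents (N := N) s w j
  have he_mem : ∀ φ ∈ vanishing N (H ⧸ U) g (j + 1), e φ ∈ vanishing N (H ⧸ U) g (j + 1) := by
    intro φ hφ b hb
    rw [weightedComponents_apply s w hφ (by omega), hφ b hb, smul_zero]
  have he_conj : ∀ (h : H), ∀ φ ∈ vanishing N (H ⧸ U) g (j + 1), ∀ b : H ⧸ U → B,
      j ≤ (zeroCoords g b).card → multilinearAction (H ⧸ U) B N h
        (e (multilinearAction (H ⧸ U) B N h⁻¹ φ)) b =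
          (if h • x₀ ∈ zeroCoords g b then a else 0) • φ b := by
    intro h φ hφ b hb
    rw [multilinearAction_apply, weightedComponents_apply s w (vanishing_le_comap _ _ hφ)
      (by rwa [card_zeroCoords_smul]), map_smul, ← multilinearAction_apply (N := N) h,
      ← Module.End.mul_apply, ← map_mul, mul_inv_cancel, map_one, Module.End.one_apply]
    simp only [w, mem_zeroCoords_smul]
  let e₁ := e.restrict he_mem
  have he₁ : (vanishing N (H ⧸ U) g j).submoduleOf (vanishing N (H ⧸ U) g (j + 1)) ≤
      ((vanishing N (H ⧸ U) g j).submoduleOf (vanishing N (H ⧸ U) g (j + 1))).comap e₁ := by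
    intro φ hφ b hb
    have hφ' : φ.1 b = 0 := hφ b hb
    exact (weightedComponents_apply s w φ.2 hb).trans (by rw [hφ', smul_zero])
  let e₂ := Submodule.mapQ _ _ e₁ he₁
  refine isZero_groupCohomology_of_trace U _ e₂ ?_ ?_ n hU
  · intro u hu v
    obtain ⟨φ, rfl⟩ := Submodule.mkQ_surjective _ v
    refine (Submodule.Quotient.eq _).2 fun b hb => ?_
    change e (multilinearAction _ _ _ u φ.1) b - multilinearAction _ _ _ u (e φ.1) b = 0
    have h1 := he_conj u _ (vanishing_le_comap _ u φ.2) b hb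
    rw [← Module.End.mul_apply (multilinearAction _ _ _ u⁻¹), ← map_mul, inv_mul_cancel, map_one,
      Module.End.one_apply] at h1
    rw [h1, weightedComponents_apply s w (vanishing_le_comap _ u φ.2) hb]
    have hux : u • x₀ = x₀ := QuotientGroup.eq.2 (by simpa using hu)
    simp only [hux, w, sub_self]
  · intro v
    obtain ⟨φ, rfl⟩ := Submodule.mkQ_surjective _ v
    let σ := (vanishingRep N (H ⧸ U) g (j + 1)).ρ
    let q := ((vanishing N (H ⧸ U) g j).submoduleOf (vanishing N (H ⧸ U) g (j + 1))).mkQ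
    change ∑ c : H ⧸ U, q (σ c.out (e₁ (σ c.out⁻¹ φ))) = q φ
    rw [← map_sum]
    refine (Submodule.Quotient.eq _).2 fun b hb => ?_
    change (∑ c : H ⧸ U, σ c.out (e₁ (σ c.out⁻¹ φ))).1 b - φ.1 b = 0
    have h1 (c : H ⧸ U) : (σ c.out (e₁ (σ c.out⁻¹ φ))).1 b =
        (if c ∈ zeroCoords g b then a else 0) • φ.1 b := by
      have hc : c.out • x₀ = c := by
        change ((c.out * 1 : H) : H ⧸ U) = c
        rw [mul_one, QuotientGroup.out_eq']
      have := he_conj c.out φ.1 φ.2 b hb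
      rwa [hc] at this
    rw [Submodule.coe_sum, sum_apply, Finset.sum_congr rfl fun c _ => h1 c, ← Finset.sum_smul,
      Finset.sum_ite_mem, Finset.univ_inter, Finset.sum_const, nsmul_eq_mul, mul_comm, sub_eq_zero]
    rcases hb.lt_or_eq with hlt | heq
    · rw [φ.2 b hlt, smul_zero]
    · rw [← heq, ha]

end GradedPieces

/-! ### Syzygies and traces -/

section Syzygies

open Limits

variable {k H : Type u} [CommRing k] [Group H] (M : Rep.{u} k H)

/-- The diagonal action of `H` on the finitely supported functions from `H` to `M`. -/
def finsuppAction : Representation k H (H →₀ M) where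
  toFun h := (Finsupp.domLCongr (Equiv.mulLeft h)).toLinearMap ∘ₗ
    Finsupp.mapRange.linearMap (M.ρ h)
  map_one' := by ext; simp
  map_mul' g h := by ext; simp

/-- The representation given by `finsuppAction`. -/
abbrev finsuppRep : Rep.{u} k H := Rep.of (finsuppAction M)

theorem finsuppAction_single (h x : H) (m : M) :
    finsuppAction M h (Finsupp.single x m) = Finsupp.single (h * x) (M.ρ h m) := by
  simp [finsuppAction]

theorem finsuppAction_apply (h x : H) (φ : H →₀ M) :
    finsuppAction M h φ x = M.ρ h (φ (h⁻¹ * x)) := by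
  simp [finsuppAction]

/-- The sum of the values, as a morphism from `finsuppRep M` to `M`. -/
def sumHom : finsuppRep M ⟶ M := Rep.ofHom
  { Finsupp.lsum k (fun _ => LinearMap.id) with
    isIntertwining' h := by ext; simp [finsuppAction_single] }

theorem sumHom_apply (φ : H →₀ M) : (sumHom M).hom φ = φ.sum fun _ m => m := rfl

theorem sumHom_single (x : H) (m : M) : (sumHom M).hom (Finsupp.single x m) = m := by
  rw [sumHom_apply]
  simp

/-- The kernel of `sumHom`, the first syzygy of `M`. -/
abbrev syzygy : Rep.{u} k H :=
  Rep.subrepresentation (finsuppRep M) (LinearMap.ker (sumHom M).hom.toLinearMap) fun h φ hφ => by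
    have : (sumHom M).hom φ = 0 := hφ
    change (sumHom M).hom ((finsuppRep M).ρ h φ) = 0
    rw [Rep.hom_comm_apply, this, map_zero]

/-- The inclusion of the syzygy. -/
def syzygyHom : syzygy M ⟶ finsuppRep M := Rep.subtype _ _ _

/-- The linear splitting of the sequence `syzygy M ⟶ finsuppRep M ⟶ M`. -/
def syzygySplitting : LinearSplitting (syzygyHom M) (sumHom M) where
  retr := LinearMap.codRestrict _
    (LinearMap.id - Finsupp.lsingle 1 ∘ₗ (sumHom M).hom.toLinearMap) fun φ => by
      change (sumHom M).hom (φ - Finsupp.single 1 ((sumHom M).hom φ)) = 0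
      rw [map_sub, sumHom_single, sub_self]
  sect := Finsupp.lsingle 1
  retr_apply φ := Subtype.ext <| by
    have : (sumHom M).hom φ.1 = 0 := φ.2
    change φ.1 - Finsupp.single 1 ((sumHom M).hom φ.1) = φ.1
    simp [this]
  apply_sect m := sumHom_single M 1 m
  apply_apply φ := φ.2
  add_eq φ := by
    change φ - Finsupp.single 1 ((sumHom M).hom φ) + Finsupp.single 1 ((sumHom M).hom φ) = φ
    simp

/-- The restriction of a linear splitting along a homomorphism of groups. -/
def LinearSplitting.res {A B C : Rep.{u} k H} {f : A ⟶ B} {g : B ⟶ C} (s : LinearSplitting f g)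
    {K : Type u} [Group K] (i : K →* H) :
    LinearSplitting ((Rep.resFunctor i).map f) ((Rep.resFunctor i).map g) where
  retr := s.retr
  sect := s.sect
  retr_apply := s.retr_apply
  apply_sect := s.apply_sect
  apply_apply := s.apply_apply
  add_eq := s.add_eq

variable (k H) in
/-- The iterated syzygies of the trivial representation. -/
def iteratedSyzygy : ℕ → Rep.{u} k H
  | 0 => Rep.trivial k H k
  | n + 1 => syzygy (iteratedSyzygy n)

variable (U : Subgroup H)

/-- Left multiplication makes `H` a free `U`-set; `e` is the projection to the coordinates in the
transversal `η = 1`. -/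
theorem exists_isTraceOne_res_finsuppRep :
    ∃ e : finsuppRep M →ₗ[k] finsuppRep M,
      IsTraceOne PUnit.unit.{u + 1} (Rep.res U.subtype (finsuppRep M)) e := by
  classical
  obtain ⟨η, hη⟩ := exists_equivariant_of_free (H := U) (Y := H) fun u x hux => by
    rw [Subgroup.smul_def, smul_eq_mul, mul_eq_right] at hux
    exact Subtype.ext hux
  let e : (H →₀ M) →ₗ[k] (H →₀ M) :=
    { toFun φ := φ.filter fun x => η x = 1
      map_add' φ ψ := Finsupp.filter_add
      map_smul' c φ := Finsupp.filter_smul }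
  have he (u : U) (φ : H →₀ M) (x : H) :
      (conjEnd (Rep.res U.subtype (finsuppRep M)) e u φ : H →₀ M) x =
        if u = (η x)⁻¹ then φ x else 0 := by
    change finsuppAction M u ((finsuppAction M u⁻¹ φ).filter fun x => η x = 1) x = _
    have hux : η ((u : H)⁻¹ * x) = η x * u := by simpa [Subgroup.smul_def] using hη u⁻¹ x
    rw [finsuppAction_apply, Finsupp.filter_apply, hux, finsuppAction_apply]
    by_cases h : η x * u = 1
    · rw [if_pos h, if_pos (eq_inv_of_mul_eq_one_right h), ← Module.End.mul_apply, ← map_mul]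
      simp
    · rw [if_neg h, if_neg fun h' => h (by rw [h', mul_inv_cancel]), map_zero]
  refine ⟨e, fun _ φ => ⟨Finset.image (fun x => (η x)⁻¹) (Finsupp.support φ),
    fun _ _ => Subsingleton.elim _ _, fun u _ hu => ?_, ?_⟩⟩
  · refine Finsupp.ext fun x => ?_
    rw [he]
    refine ite_eq_right_iff.2 fun h => ?_
    by_contra hx
    exact hu (Finset.mem_image.2 ⟨x, Finsupp.mem_support_iff.2 hx, h.symm⟩)
  · refine Finsupp.ext fun x => ?_
    refine (Finsupp.finsetSum_apply _ _ _).trans ?_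
    rw [Finset.sum_congr rfl fun u _ => he u φ x, Finset.sum_ite_eq']
    refine ite_eq_left_iff.2 fun hx => ?_
    by_contra hx'
    exact hx (Finset.mem_image.2 ⟨x, Finsupp.mem_support_iff.2 (Ne.symm hx'), rfl⟩)

theorem IsTraceOne.of_res {M : Rep.{u} k H} {e : M →ₗ[k] M}
    (he : IsTraceOne PUnit.unit.{u + 1} (Rep.res U.subtype M) e) :
    IsTraceOne ((1 : H) : H ⧸ U) M e := by
  classical
  intro x m
  obtain ⟨t, rfl⟩ := QuotientGroup.mk_surjective x
  obtain ⟨A, -, hA, hA'⟩ := he PUnit.unit (M.ρ t⁻¹ m)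
  have hx (h : H) : h • ((1 : H) : H ⧸ U) = t ↔ t⁻¹ * h ∈ U := by
    rw [← QuotientGroup.eq, eq_comm]
    change (t : H ⧸ U) = ((h * 1 : H) : H ⧸ U) ↔ _
    rw [mul_one]
  have hconj (u : U) : conjEnd M e (t * u) m =
      M.ρ t (conjEnd (Rep.res U.subtype M) e u (M.ρ t⁻¹ m)) := by
    simp [conjEnd]
  refine ⟨A.image fun u : U => t * (u : H), fun h hh => ?_, fun h hh hhA => ?_, ?_⟩
  · obtain ⟨u, -, rfl⟩ := Finset.mem_image.1 hh
    exact (hx _).2 (by simp)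
  · obtain ⟨u, rfl⟩ : ∃ u : U, h = t * u := ⟨⟨t⁻¹ * h, (hx h).1 hh⟩, by simp⟩
    rw [hconj, hA u (Subsingleton.elim _ _) fun hu => hhA (Finset.mem_image_of_mem _ hu), map_zero]
  · rw [Finset.sum_image fun u _ v _ huv => by simpa using huv, Finset.sum_congr rfl
      fun u _ => hconj u, ← map_sum, hA', ← Module.End.mul_apply, ← map_mul]
    simp

/-- A representation whose first cohomology with coefficients in all `Hom`-representations vanishes
is the image of a trace. -/
theorem exists_isTraceOne_of_isZero
    (h : ∀ W : Rep.{u} k H, IsZero (groupCohomology (multilinearRep PUnit.{u + 1} M W) 1)) :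
    ∃ e : M →ₗ[k] M, IsTraceOne PUnit.unit.{u + 1} M e := by
  let S := multilinearRep PUnit.{u + 1} M (syzygy M)
  let lin : (M →ₗ[k] syzygy M) → MultilinearMap k (fun _ : PUnit.{u + 1} => M) (syzygy M) :=
    fun l => MultilinearMap.ofSubsingleton k M (syzygy M) PUnit.unit l
  -- This cocycle measures the failure of `m ↦ single 1 m` to be equivariant. A primitive `τ`
  -- corrects that map to an equivariant section `s` of `sumHom`, and the required endomorphism is
  -- the coefficient of `s` at `1`.
  let c (h : H) : M →ₗ[k] syzygy M := LinearMap.codRestrict _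
    (Finsupp.lsingle h - Finsupp.lsingle 1) fun m => by
      change (sumHom M).hom (Finsupp.single h m - Finsupp.single 1 m) = 0
      rw [map_sub, sumHom_single, sumHom_single, sub_self]
  have hc (h : H) (m : M) : (c h m).1 = Finsupp.single h m - Finsupp.single 1 m := rfl
  have hcoc : (fun h => lin (c h) : H → S) ∈ groupCohomology.cocycles₁ S := by
    rw [groupCohomology.mem_cocycles₁_iff]
    intro g h
    refine MultilinearMap.ext fun m => Subtype.ext ?_
    change (c (g * h) (m PUnit.unit)).1 =
      finsuppAction M g (c h (M.ρ g⁻¹ (m PUnit.unit))).1 + (c g (m PUnit.unit)).1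
    simp only [hc, map_sub, finsuppAction_single]
    simp
  have hzero : groupCohomology.H1π S ⟨_, hcoc⟩ = 0 := by
    have := ModuleCat.subsingleton_of_isZero (h (syzygy M))
    exact Subsingleton.elim _ _
  rw [groupCohomology.H1π_eq_zero_iff] at hzero
  obtain ⟨τ, hτ⟩ := hzero
  let τ' : M →ₗ[k] syzygy M := (MultilinearMap.ofSubsingleton k M (syzygy M) PUnit.unit).symm τ
  let s : M →ₗ[k] (H →₀ M) := Finsupp.lsingle 1 - Submodule.subtype _ ∘ₗ τ'
  have hs (h : H) (m : M) : finsuppAction M h (s (M.ρ h⁻¹ m)) = s m := by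
    have h1 : finsuppAction M h (τ' (M.ρ h⁻¹ m)).1 - (τ' m).1 =
        Finsupp.single h m - Finsupp.single 1 m :=
      congrArg (fun l : MultilinearMap k (fun _ : PUnit.{u + 1} => M) (syzygy M) =>
        (l fun _ => m).1) (congrFun hτ h)
    change finsuppAction M h (Finsupp.single 1 (M.ρ h⁻¹ m) - (τ' (M.ρ h⁻¹ m)).1) =
      Finsupp.single 1 m - (τ' m).1
    rw [map_sub, sub_eq_iff_eq_add.1 h1, finsuppAction_single, ← Module.End.mul_apply, ← map_mul]
    simp only [mul_one, mul_inv_cancel, map_one, Module.End.one_apply]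
    abel
  have hsum (m : M) : (s m).sum (fun _ x => x) = m := by
    have h1 : (sumHom M).hom (τ' m).1 = 0 := (τ' m).2
    rw [← sumHom_apply]
    change (sumHom M).hom (Finsupp.single 1 m - (τ' m).1) = m
    rw [map_sub, h1, sumHom_single, sub_zero]
  have he (h : H) (m : M) : conjEnd M (Finsupp.lapply 1 ∘ₗ s) h m = s m h := by
    rw [← hs h m, finsuppAction_apply, inv_mul_cancel]
    rfl
  refine ⟨Finsupp.lapply 1 ∘ₗ s, fun _ m => ⟨(s m).support, fun _ _ => Subsingleton.elim _ _,
    fun h _ hh => ?_, ?_⟩⟩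
  · rw [he]
    exact Finsupp.notMem_support_iff.1 hh
  · rw [Finset.sum_congr rfl fun h _ => he h m]
    exact hsum m

end Syzygies

/-! ### A `p`-local form of Serre's theorem -/

section Serre

open Limits

variable {k H : Type u} [CommRing k] [Group H] (U : Subgroup H)

/-- Dimension shifting: for a one-point `X` the filtration is the `Hom` sequence of the syzygy
sequence, whose middle term is acyclic in positive degrees. Each syzygy lowers the bound by one. -/
theorem isZero_groupCohomology_multilinearRep_iteratedSyzygy {N : ℕ}
    (hU : CohomologyVanishesFrom k U N) (i n : ℕ) (hn : N ≤ n + 1 + i) (W : Rep.{u} k U) :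
    IsZero (groupCohomology
      (multilinearRep PUnit.{u + 1} (Rep.res U.subtype (iteratedSyzygy k H i)) W) (n + 1)) := by
  induction i generalizing n with
  | zero => exact hU _ _ hn
  | succ i ih =>
    let s := (syzygySplitting (iteratedSyzygy k H i)).res U.subtype
    obtain ⟨e, he⟩ := exists_isTraceOne_res_finsuppRep (iteratedSyzygy k H i) U
    refine isZero_groupCohomology_multilinearRep_left (X := PUnit.{u + 1}) (N := W) s (n + 1)
      (isZero_groupCohomology_multilinearRep he (fun u y huy => ?_) n) ?_
    · have := congrFun (congrArg Subtype.val huy) PUnit.unit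
      rwa [OrbitSection.smul_apply, Subsingleton.elim (u⁻¹ • PUnit.unit) PUnit.unit,
        mul_eq_right] at this
    · rw [Fintype.card_punit]
      exact isZero_groupCohomology_of_retract (vanishingRepOneIso s).inv (vanishingRepOneIso s).hom
        (vanishingRepOneIso s).inv_hom_id _ (ih (n + 1) (by omega))

theorem exists_isTraceOne_iteratedSyzygy {N : ℕ} (hU : CohomologyVanishesFrom k U N) :
    ∃ e : iteratedSyzygy k H N →ₗ[k] iteratedSyzygy k H N,
      IsTraceOne ((1 : H) : H ⧸ U) (iteratedSyzygy k H N) e := by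
  obtain ⟨e, he⟩ := exists_isTraceOne_of_isZero (Rep.res U.subtype (iteratedSyzygy k H N))
    fun W => isZero_groupCohomology_multilinearRep_iteratedSyzygy U hU N 0 (by omega) W
  exact ⟨e, he.of_res⟩

theorem isZero_groupCohomology_of_multilinearRep_trivial {X : Type u} [MulAction H X] [Fintype X]
    {W : Rep.{u} k H} {n : ℕ}
    (h : IsZero (groupCohomology (multilinearRep X (Rep.trivial k H k) W) n)) :
    IsZero (groupCohomology W n) := by
  let i : W ⟶ multilinearRep X (Rep.trivial k H k) W := Rep.ofHom
    { (MultilinearMap.piRingEquiv (R := k) (ι := X) (M₂ := W)).toLinearMap with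
      isIntertwining' h := by
        refine LinearMap.ext fun w => MultilinearMap.ext fun (m : X → k) => ?_
        change (∏ x, m x) • W.ρ h w = W.ρ h ((∏ x, m (h • x)) • w)
        rw [map_smul]
        congr 1
        exact (Fintype.prod_equiv (MulAction.toPerm h) _ _ fun x => rfl).symm }
  let r : multilinearRep X (Rep.trivial k H k) W ⟶ W := Rep.ofHom
    { toFun (f : MultilinearMap k (fun _ : X => k) W) := f 1
      map_add' f g := rfl
      map_smul' c f := rfl
      isIntertwining' h := by ext f; rfl }
  refine isZero_groupCohomology_of_retract i r ?_ n h
  ext w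
  change (∏ x : X, (1 : k)) • w = w
  simp

variable {p : ℕ}

/-- If `h` fixes `y`, then `h ^ p` lies in `U` and fixes the base coset. Hence left multiplication
by `h ^ p` fixes the value of `y` there, so `h ^ p = 1`. -/
theorem eq_one_of_smul_orbitSection_eq [U.Normal] (hcard : Nat.card (H ⧸ U) = p)
    (htf : ∀ h : H, h ^ p = 1 → h = 1) (h : H) (y : OrbitSection H ((1 : H) : H ⧸ U))
    (hy : h • y = y) : h = 1 := by
  refine htf h ?_
  have hpy : (h ^ p) • y = y := by
    have : h ∈ MulAction.stabilizer H y := hy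
    exact pow_mem this p
  have hpU : h ^ p ∈ U := by
    rw [← QuotientGroup.eq_one_iff, QuotientGroup.mk_pow, ← hcard]
    exact pow_card_eq_one'
  have := congrFun (congrArg Subtype.val hpy) ((1 : H) : H ⧸ U)
  have h1 : (h ^ p)⁻¹ • ((1 : H) : H ⧸ U) = ((1 : H) : H ⧸ U) := by
    change (((h ^ p)⁻¹ * 1 : H) : H ⧸ U) = _
    rw [mul_one, QuotientGroup.eq]
    simpa using hpU
  rwa [OrbitSection.smul_apply, h1, mul_eq_right] at this

theorem exists_mul_smul_eq (hp : p.Prime) {W : Type*} [AddCommGroup W] [Module k W]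
    (hW : ∀ v : W, (p : k) • v = 0) {j : ℕ} (hj : 0 < j) (hjp : j < p) :
    ∃ a : k, ∀ v : W, (a * j) • v = v := by
  have hco : Nat.gcd j p = 1 := Nat.Coprime.symm
    ((Nat.Prime.coprime_iff_not_dvd hp).2 (Nat.not_dvd_of_pos_of_lt hj hjp))
  have hab := Nat.gcd_eq_gcd_ab j p
  refine ⟨(Nat.gcdA j p : k), fun v => ?_⟩
  have : ((Nat.gcdA j p : k) * j) = 1 - (Nat.gcdB j p : k) * p := by
    rw [hco] at hab
    have := congrArg (Int.cast (R := k)) hab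
    push_cast at this
    rw [this]
    ring
  rw [this, sub_smul, mul_smul, hW, smul_zero, sub_zero, one_smul]

/-- Descent through the filtration. Level `p` is controlled by the syzygy and the acyclic middle
term, each step down by a graded piece with `0 < j < p`, and level `1` is the representation
attached to `M`. -/
theorem exists_isZero_groupCohomology_of_syzygy [Fintype (H ⧸ U)] (hp : p.Prime)
    (hcard : Fintype.card (H ⧸ U) = p) {N : ℕ} (hU : CohomologyVanishesFrom k U N)
    (hfree : ∀ (h : H) (y : OrbitSection H ((1 : H) : H ⧸ U)), h • y = y → h = 1)
    {W : Rep.{u} k H} (hW : ∀ v : W, (p : k) • v = 0) (M : Rep.{u} k H)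
    (h : ∃ n₀, ∀ n ≥ n₀, IsZero (groupCohomology (multilinearRep (H ⧸ U) (syzygy M) W) n)) :
    ∃ n₀, ∀ n ≥ n₀, IsZero (groupCohomology (multilinearRep (H ⧸ U) M W) n) := by
  let s := syzygySplitting M
  have key : ∀ i < p, ∃ n₀, ∀ n ≥ n₀,
      IsZero (groupCohomology (vanishingRep W (H ⧸ U) (sumHom M) (p - i)) n) := by
    intro i hi
    induction i with
    | zero =>
      obtain ⟨n₀, hn₀⟩ := h
      refine ⟨n₀ + 1, fun n hn => ?_⟩
      obtain ⟨m, rfl⟩ : ∃ m, n = m + 1 := ⟨n - 1, by omega⟩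
      obtain ⟨e, he⟩ := exists_isTraceOne_res_finsuppRep M U
      have := isZero_groupCohomology_vanishingRep_card (X := H ⧸ U) (N := W) s m
        (hn₀ m (by omega)) (isZero_groupCohomology_multilinearRep (he.of_res) hfree m)
      rwa [hcard] at this
    | succ i ih =>
      obtain ⟨n₀, hn₀⟩ := ih (by omega)
      refine ⟨n₀ + N + 1, fun n hn => ?_⟩
      obtain ⟨m, rfl⟩ : ∃ m, n = m + 1 := ⟨n - 1, by omega⟩
      obtain ⟨a, ha⟩ := exists_mul_smul_eq hp hW (j := p - (i + 1)) (by omega) (by omega)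
      have hi' : p - i = p - (i + 1) + 1 := by omega
      refine isZero_groupCohomology_vanishingRep _ m
        (isZero_groupCohomology_gradedPiece s _ m a ha (hU _ m (by omega))) ?_
      rw [← hi']
      exact hn₀ _ (by omega)
  obtain ⟨n₀, hn₀⟩ := key (p - 1) (Nat.sub_lt hp.pos one_pos)
  rw [Nat.sub_sub_self hp.one_le] at hn₀
  exact ⟨n₀, fun n hn => isZero_groupCohomology_of_retract (vanishingRepOneIso s).hom
    (vanishingRepOneIso s).inv (vanishingRepOneIso s).hom_inv_id n (hn₀ n hn)⟩

/-- An extension of a group of order `p` by a group whose cohomology vanishes in high degrees has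
vanishing mod `p` cohomology in high degrees, if it has no elements of order `p`. -/
theorem exists_isZero_groupCohomology [U.Normal] (hp : p.Prime) (hcard : Nat.card (H ⧸ U) = p)
    {N : ℕ} (hU : CohomologyVanishesFrom k U N) (htf : ∀ h : H, h ^ p = 1 → h = 1)
    (W : Rep.{u} k H) (hW : ∀ v : W, (p : k) • v = 0) :
    ∃ n₀, ∀ n ≥ n₀, IsZero (groupCohomology W n) := by
  have : Finite (H ⧸ U) := Nat.finite_of_card_ne_zero (by rw [hcard]; exact hp.ne_zero)
  have := Fintype.ofFinite (H ⧸ U)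
  have hfree := eq_one_of_smul_orbitSection_eq U hcard htf
  have key : ∀ i ≤ N, ∃ n₀, ∀ n ≥ n₀, IsZero (groupCohomology
      (multilinearRep (H ⧸ U) (iteratedSyzygy k H (N - i)) W) n) := by
    intro i hi
    induction i with
    | zero =>
      obtain ⟨e, he⟩ := exists_isTraceOne_iteratedSyzygy (k := k) U hU
      refine ⟨1, fun n hn => ?_⟩
      obtain ⟨m, rfl⟩ : ∃ m, n = m + 1 := ⟨n - 1, by omega⟩
      exact isZero_groupCohomology_multilinearRep he hfree m
    | succ i ih =>
      have hi' : N - i = N - (i + 1) + 1 := by omega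
      have := ih (by omega)
      rw [hi'] at this
      exact exists_isZero_groupCohomology_of_syzygy U hp
        (by rw [← hcard, Nat.card_eq_fintype_card]) hU hfree hW _ this
  obtain ⟨n₀, hn₀⟩ := key N le_rfl
  rw [Nat.sub_self] at hn₀
  exact ⟨n₀, fun n hn => isZero_groupCohomology_of_multilinearRep_trivial (hn₀ n hn)⟩

end Serre

/-! ### Partial products of tuples -/

section PartialProd

theorem Fin.partialProd_injective {G : Type*} [Group G] {n : ℕ} :
    Function.Injective (Fin.partialProd : (Fin n → G) → Fin (n + 1) → G) := fun s t h => by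
  ext i
  rw [← Fin.partialProd_right_inv s, ← Fin.partialProd_right_inv t, h]

theorem Fin.map_partialProd {G G' : Type*} [Monoid G] [Monoid G'] (f : G →* G') {n : ℕ}
    (g : Fin n → G) (i : Fin (n + 1)) :
    f (Fin.partialProd g i) = Fin.partialProd (fun i => f (g i)) i := by
  induction i using Fin.induction with
  | zero => simp
  | succ i ih => rw [Fin.partialProd_succ, Fin.partialProd_succ, map_mul, ih]

theorem Fin.continuous_partialProd {G : Type*} [Monoid G] [TopologicalSpace G] [ContinuousMul G]
    {n : ℕ} (i : Fin (n + 1)) : Continuous fun g : Fin n → G => Fin.partialProd g i := by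
  induction i using Fin.induction with
  | zero => simpa using continuous_const
  | succ i ih =>
    simp only [Fin.partialProd_succ]
    exact ih.mul (continuous_apply i)

end PartialProd

/-! ### Shapiro's lemma on explicit cochains -/

section Coinduction

variable {k Γ : Type u} [CommRing k] [Group Γ]

/-- The permutation representation on the functions from a `Γ`-set `Y` to `W`. -/
def functionAction (k : Type u) [CommRing k] (Γ : Type u) [Group Γ] (Y W : Type u) [MulAction Γ Y]
    [AddCommGroup W] [Module k W] : Representation k Γ (Y → W) where
  toFun g := LinearMap.funLeft k W (g⁻¹ • ·)
  map_one' := by ext; simp [LinearMap.funLeft_apply]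
  map_mul' g h := by ext; simp [LinearMap.funLeft_apply, mul_smul]

/-- The representation given by `functionAction`. -/
abbrev functionRep (k : Type u) [CommRing k] (Γ : Type u) [Group Γ] (Y W : Type u) [MulAction Γ Y]
    [AddCommGroup W] [Module k W] : Rep.{u} k Γ := Rep.of (functionAction k Γ Y W)

theorem functionAction_apply {Y W : Type u} [MulAction Γ Y] [AddCommGroup W] [Module k W] (g : Γ)
    (a : Y → W) (y : Y) : functionAction k Γ Y W g a y = a (g⁻¹ • y) := rfl

variable {K : Subgroup Γ} {C : Type u} [CommGroup C] (χ : K →* C)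

/-- The cocycle `Γ → (Γ ⧸ K → C)` which corresponds to the homomorphism `χ : K → C` by Shapiro's
lemma. -/
def shapiroCocycle (g : Γ) (y : Γ ⧸ K) : C :=
  χ ⟨y.out⁻¹ * (g * (g⁻¹ • y).out), by
    rw [← QuotientGroup.eq, QuotientGroup.out_eq', ← smul_eq_mul,
      MulAction.Quotient.coe_smul_out, smul_inv_smul]⟩

theorem shapiroCocycle_mul (g h : Γ) (y : Γ ⧸ K) :
    shapiroCocycle χ (g * h) y = shapiroCocycle χ g y * shapiroCocycle χ h (g⁻¹ • y) := by
  rw [shapiroCocycle, shapiroCocycle, shapiroCocycle, ← map_mul]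
  congr 1
  ext
  simp [mul_smul, mul_assoc]

theorem shapiroCocycle_one (y : Γ ⧸ K) : shapiroCocycle χ 1 y = 1 := by
  simpa using shapiroCocycle_mul χ 1 1 y

/-- The chosen representative of the trivial coset lies in `K` and only conjugates `g`, which is
invisible in the commutative group `C`. -/
theorem shapiroCocycle_mk_one (g : K) :
    shapiroCocycle χ (g : Γ) ((1 : Γ) : Γ ⧸ K) = χ g := by
  have h1 : (((1 : Γ) : Γ ⧸ K)).out ∈ K := by
    have := QuotientGroup.mk_out_eq_mul K (1 : Γ)
    obtain ⟨h, hh⟩ := this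
    rw [hh, one_mul]
    exact h.2
  have h2 : (g : Γ)⁻¹ • ((1 : Γ) : Γ ⧸ K) = ((1 : Γ) : Γ ⧸ K) := by
    change (((g : Γ)⁻¹ * 1 : Γ) : Γ ⧸ K) = _
    rw [QuotientGroup.eq]
    simp
  have h3 : shapiroCocycle χ (g : Γ) ((1 : Γ) : Γ ⧸ K) =
      χ (⟨_, h1⟩⁻¹ * (g * ⟨_, h1⟩)) := by
    rw [shapiroCocycle]
    congr 1
    ext
    simp [h2]
  rw [h3, map_mul, map_mul, map_inv, mul_comm (χ g), inv_mul_cancel_left]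

/-- The tuple of values of `shapiroCocycle` along a tuple of group elements. -/
def shapiroTuple {n : ℕ} (g : Fin n → Γ) (y : Γ ⧸ K) (i : Fin n) : C :=
  shapiroCocycle χ (g i) ((Fin.partialProd g i.castSucc)⁻¹ • y)

/-- Partial products determine a tuple, so this reduces the compatibility with contractions to that
of partial products. -/
theorem partialProd_shapiroTuple {n : ℕ} (g : Fin n → Γ) (y : Γ ⧸ K) (i : Fin (n + 1)) :
    Fin.partialProd (shapiroTuple χ g y) i = shapiroCocycle χ (Fin.partialProd g i) y := by
  induction i using Fin.induction with
  | zero => simp [shapiroCocycle_one]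
  | succ i ih => rw [Fin.partialProd_succ, Fin.partialProd_succ, shapiroCocycle_mul, ih]; rfl

theorem shapiroTuple_contractNth {n : ℕ} (g : Fin (n + 1) → Γ) (y : Γ ⧸ K) (j : Fin (n + 1)) :
    shapiroTuple χ (Fin.contractNth j (· * ·) g) y =
      Fin.contractNth j (· * ·) (shapiroTuple χ g y) := by
  refine Fin.partialProd_injective (funext fun i => ?_)
  rw [partialProd_shapiroTuple, Fin.partialProd_contractNth, Fin.partialProd_contractNth]
  exact (partialProd_shapiroTuple χ g y _).symm

theorem shapiroTuple_tail {n : ℕ} (g : Fin (n + 1) → Γ) (y : Γ ⧸ K) :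
    shapiroTuple χ (fun i => g i.succ) ((g 0)⁻¹ • y) = fun i => shapiroTuple χ g y i.succ := by
  ext i
  have : Fin.partialProd g i.castSucc.succ = g 0 * Fin.partialProd (fun i => g i.succ) i.castSucc :=
    Fin.partialProd_succ' g i.castSucc
  rw [shapiroTuple, shapiroTuple, ← Fin.succ_castSucc, this, mul_inv_rev, mul_smul]

variable {W : Type u} [AddCommGroup W] [Module k W]

/-- The cochain of `Γ` with values in the functions on `Γ ⧸ K` which corresponds to a cochain of `C`
with trivial coefficients. -/
def shapiroCochain {n : ℕ} (f : (Fin n → C) → W) (g : Fin n → Γ) (y : Γ ⧸ K) : W :=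
  f (shapiroTuple χ g y)

theorem d_shapiroCochain {n : ℕ} (f : (Fin n → C) → W) :
    (inhomogeneousCochains.d (functionRep k Γ (Γ ⧸ K) W) n).hom (shapiroCochain χ f) =
      shapiroCochain χ ((inhomogeneousCochains.d (Rep.trivial k C W) n).hom f) := by
  ext g y
  rw [inhomogeneousCochains.d_hom_apply]
  simp only [Pi.add_apply, Finset.sum_apply, Pi.smul_apply]
  rw [functionAction_apply]
  simp only [shapiroCochain, shapiroTuple_contractNth, shapiroTuple_tail,
    inhomogeneousCochains.d_hom_apply]
  rfl

/-- Evaluation at the base point, as a morphism to the trivial representation of a group that maps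
to `K`. -/
def evalHom (τ : C →* Γ) (hτ : ∀ c, τ c ∈ K) :
    Rep.res τ (functionRep k Γ (Γ ⧸ K) W) ⟶ Rep.trivial k C W := Rep.ofHom
  { LinearMap.proj ((1 : Γ) : Γ ⧸ K) with
    isIntertwining' c := by
      ext a
      change a ((τ c)⁻¹ • ((1 : Γ) : Γ ⧸ K)) = a ((1 : Γ) : Γ ⧸ K)
      congr 1
      change (((τ c)⁻¹ * 1 : Γ) : Γ ⧸ K) = _
      rw [QuotientGroup.eq]
      simpa using hτ c }

theorem eval_shapiroCochain (τ : C →* Γ) (hτ : ∀ c, τ c ∈ K) (hχ : ∀ c, χ ⟨τ c, hτ c⟩ = c)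
    {n : ℕ} (f : (Fin n → C) → W) :
    ((groupCohomology.cochainsMap τ (evalHom (k := k) (W := W) τ hτ)).f n).hom
      (shapiroCochain χ f) = f := by
  ext c
  change f (shapiroTuple χ (fun i => τ (c i)) ((1 : Γ) : Γ ⧸ K)) = f c
  congr 1
  refine Fin.partialProd_injective (funext fun i => ?_)
  rw [partialProd_shapiroTuple, ← Fin.map_partialProd]
  exact (shapiroCocycle_mk_one χ ⟨τ (Fin.partialProd c i), hτ _⟩).trans (hχ _)

end Coinduction

/-! ### Continuous cochains and the split quotient `C` -/

section Continuity

open Limits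

theorem contCochainComplex_d {k Γ : Type u} [CommRing k] [Group Γ] [TopologicalSpace Γ]
    [IsTopologicalGroup Γ] (A : Rep.{u} k Γ) (hA : IsDiscreteModule A) (n : ℕ) :
    (contCochainComplex A hA).d n (n + 1) = contCochainsD A hA n := by
  simp only [contCochainComplex, CochainComplex.of_d]

variable {k Γ : Type u} [CommRing k] [Group Γ] [TopologicalSpace Γ] [IsTopologicalGroup Γ]
  {K : Subgroup Γ}

theorem isLocallyConstant_inv_smul {T : Type*} [TopologicalSpace T] (hK : IsOpen (K : Set Γ))
    {φ : T → Γ} (hφ : Continuous φ) (y : Γ ⧸ K) : IsLocallyConstant fun t => (φ t)⁻¹ • y := by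
  have := QuotientGroup.discreteTopology hK
  rw [IsLocallyConstant.iff_continuous]
  fun_prop

variable {C : Type u} [CommGroup C] {χ : K →* C}

theorem isLocallyConstant_shapiroCocycle (hK : IsOpen (K : Set Γ)) (hχ : IsLocallyConstant χ)
    (y : Γ ⧸ K) : IsLocallyConstant fun g => shapiroCocycle χ g y := by
  refine hχ.comp_continuous (Continuous.subtype_mk ?_ _)
  exact continuous_const.mul (continuous_id.mul
    ((isLocallyConstant_inv_smul hK continuous_id y).comp Quotient.out).continuous)

variable [CompactSpace Γ] {W : Type u} [AddCommGroup W] [Module k W]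

theorem isDiscreteModule_functionRep (hK : IsOpen (K : Set Γ)) :
    IsDiscreteModule (functionRep k Γ (Γ ⧸ K) W) := by
  intro a
  have : Finite (Γ ⧸ K) := K.quotient_finite_of_isOpen hK
  rw [IsLocallyConstant.iff_eventually_eq]
  intro g
  have h := Filter.eventually_all.2 fun y : Γ ⧸ K =>
    (isLocallyConstant_inv_smul hK continuous_id y).eventually_eq g
  filter_upwards [h] with g' hg'
  ext y
  exact congrArg a (hg' y)

theorem shapiroCochain_mem_contCochains (hK : IsOpen (K : Set Γ)) (hχ : IsLocallyConstant χ) {n : ℕ}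
    (f : (Fin n → C) → W) :
    shapiroCochain χ f ∈ contCochains (functionRep k Γ (Γ ⧸ K) W) n := by
  have : Finite (Γ ⧸ K) := K.quotient_finite_of_isOpen hK
  change IsLocallyConstant _
  rw [IsLocallyConstant.iff_eventually_eq]
  intro g
  have h1 := Filter.eventually_all.2 fun y : Γ ⧸ K => Filter.eventually_all.2 fun i : Fin n =>
    (isLocallyConstant_inv_smul hK (Fin.continuous_partialProd i.castSucc) y).eventually_eq g
  have h2 := Filter.eventually_all.2 fun y : Γ ⧸ K => Filter.eventually_all.2 fun i : Fin n =>
    ((isLocallyConstant_shapiroCocycle hK hχ y).comp_continuous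
      (continuous_apply (A := fun _ : Fin n => Γ) i)).eventually_eq g
  filter_upwards [h1, h2] with g' h1 h2
  ext y
  refine congrArg f (funext fun i => ?_)
  rw [shapiroTuple, h1 y i]
  exact h2 _ i

/-- As `τ` splits `χ`, restriction along `τ` followed by evaluation at the base point is left
inverse to `shapiroCochain`. It carries a primitive of the continuous cocycle attached to `f` to a
primitive of `f`. -/
theorem isZero_groupCohomology_of_isZero_contCohomology (hK : IsOpen (K : Set Γ))
    (hχ : IsLocallyConstant χ) (τ : C →* Γ) (hτ : ∀ c, τ c ∈ K) (hχτ : ∀ c, χ ⟨τ c, hτ c⟩ = c)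
    (n : ℕ) (h : IsZero (contCohomology (functionRep k Γ (Γ ⧸ K) W)
      (isDiscreteModule_functionRep hK) (n + 1))) :
    IsZero (groupCohomology (Rep.trivial k C W) (n + 1)) := by
  set M := functionRep k Γ (Γ ⧸ K) W
  have hM : IsDiscreteModule M := isDiscreteModule_functionRep hK
  have hexact : ((contCochainComplex M hM).sc' n (n + 1) (n + 2)).Exact := by
    rw [← HomologicalComplex.exactAt_iff' _ _ _ _ (by simp) (by simp),
      HomologicalComplex.exactAt_iff_isZero_homology]
    exact h
  rw [ShortComplex.moduleCat_exact_iff] at hexact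
  change IsZero ((groupCohomology.inhomogeneousCochains (Rep.trivial k C W)).homology (n + 1))
  rw [← HomologicalComplex.exactAt_iff_isZero_homology,
    HomologicalComplex.exactAt_iff' _ n (n + 1) (n + 2) (by simp) (by simp),
    ShortComplex.moduleCat_exact_iff]
  intro (f : (Fin (n + 1) → C) → W) hf
  have hf' : (inhomogeneousCochains.d (Rep.trivial k C W) (n + 1)).hom f = 0 := by
    rw [← groupCohomology.inhomogeneousCochains.d_def]
    exact hf
  let F : contCochains M (n + 1) := ⟨_, shapiroCochain_mem_contCochains (k := k) hK hχ f⟩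
  have hF : (contCochainsD M hM (n + 1)).hom F = 0 := by
    refine Subtype.ext ((d_shapiroCochain χ f).trans ?_)
    rw [hf']
    rfl
  obtain ⟨F', hF'⟩ := hexact F (by
    change ((contCochainComplex M hM).d (n + 1) (n + 2)).hom F = 0
    rw [contCochainComplex_d]
    exact hF)
  have hF'' : (contCochainsD M hM n).hom F' = F := by
    rw [← contCochainComplex_d]
    exact hF'
  let R := groupCohomology.cochainsMap τ (evalHom (k := k) (W := W) τ hτ)
  refine ⟨(R.f n).hom F'.1, ?_⟩
  have hd : ((groupCohomology.inhomogeneousCochains M).d n (n + 1)).hom F'.1 =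
      shapiroCochain χ f := by
    rw [groupCohomology.inhomogeneousCochains.d_def]
    exact congrArg Subtype.val hF''
  have hcomm := congrArg (fun l => l.hom F'.1) (R.comm n (n + 1))
  refine hcomm.trans ?_
  change (R.f (n + 1)).hom (((groupCohomology.inhomogeneousCochains M).d n (n + 1)).hom F'.1) = f
  rw [hd]
  exact eval_shapiroCochain χ τ hτ hχτ f

end Continuity

/-! ### Cohomology of cyclic groups -/

section Cyclic

open Limits

/-- In positive even degrees the cohomology is invariants modulo norms, and the norm is
multiplication by the order of `C`, which kills `W`. -/
theorem not_isZero_groupCohomology_of_cyclic {k C : Type u} [CommRing k] [CommGroup C] [Finite C]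
    (c : C) (hc : ∀ x, x ∈ Subgroup.zpowers c) {W : Type u} [AddCommGroup W] [Module k W]
    [Nontrivial W] (hW : ∀ w : W, Nat.card C • w = 0) {n : ℕ} (hn : n ≠ 0) (hn' : Even n) :
    ¬ IsZero (groupCohomology (Rep.trivial k C W) n) := by
  intro h
  have := Fintype.ofFinite C
  have : NeZero n := ⟨hn⟩
  obtain ⟨w, hw⟩ := exists_ne (0 : W)
  have hsub := ModuleCat.subsingleton_of_isZero h
  let A := Rep.trivial k C W
  let x : LinearMap.ker (A.applyAsHom c - 𝟙 A).hom.toLinearMap := ⟨w, by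
    change w - w = 0
    simp⟩
  have hx := (Rep.FiniteCyclicGroup.groupCohomologyπEven_eq_zero_iff A c hc n hn' x).1
    (Subsingleton.elim _ _)
  obtain ⟨v, hv⟩ := hx
  refine hw (hv.symm.trans ?_)
  have : A.norm.hom v = ∑ _x : C, v := by
    simp [A, Rep.norm, Representation.norm]
  exact this.trans (by simpa [Nat.card_eq_fintype_card] using hW v)

end Cyclic

/-! ### Shapiro's lemma for the abstract group -/

section Comparison

open Limits

/-- A function on `Γ ⧸ K` restricts to a function on a dense subgroup `G`, which is coinduced from
the preimage of `K` in `G`. -/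
theorem isZero_groupCohomology_res_functionRep {k G Γ : Type u} [CommRing k] [Group G] [Group Γ]
    (ι : G →* Γ) (K : Subgroup Γ) (hι : ∀ x : Γ, ∃ g : G, (ι g : Γ ⧸ K) = x) (W : Type u)
    [AddCommGroup W] [Module k W] (n : ℕ)
    (h : IsZero (groupCohomology (Rep.trivial k (K.comap ι) W) n)) :
    IsZero (groupCohomology (Rep.res ι (functionRep k Γ (Γ ⧸ K) W)) n) := by
  choose s hs using hι
  let σ : Γ ⧸ K → G := fun y => s y.out
  have hσ (y : Γ ⧸ K) : (ι (σ y) : Γ ⧸ K) = y := by rw [hs, QuotientGroup.out_eq']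
  let A := Rep.trivial k (K.comap ι) W
  let i : Rep.res ι (functionRep k Γ (Γ ⧸ K) W) ⟶ Rep.coind (K.comap ι).subtype A := Rep.ofHom
    { toFun a := ⟨fun g => a ((ι g⁻¹ : Γ) : Γ ⧸ K), fun x g => by
        change a _ = a _
        congr 1
        rw [QuotientGroup.eq]
        have hx : ι x ∈ K := x.2
        simpa using hx⟩
      map_add' _ _ := rfl
      map_smul' _ _ := rfl
      isIntertwining' g := by
        ext a x
        change a ((ι g)⁻¹ • ((ι x⁻¹ : Γ) : Γ ⧸ K)) = a ((ι (x * g)⁻¹ : Γ) : Γ ⧸ K)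
        congr 1
        change (((ι g)⁻¹ * ι x⁻¹ : Γ) : Γ ⧸ K) = _
        simp }
  let r : Rep.coind (K.comap ι).subtype A ⟶ Rep.res ι (functionRep k Γ (Γ ⧸ K) W) := Rep.ofHom
    { toFun φ y := φ.1 (σ y)⁻¹
      map_add' _ _ := rfl
      map_smul' _ _ := rfl
      isIntertwining' g := by
        ext φ y
        change φ.1 ((σ y)⁻¹ * g) = φ.1 (σ ((ι g)⁻¹ • y))⁻¹
        have hmem : (σ y)⁻¹ * g * σ ((ι g)⁻¹ • y) ∈ K.comap ι := by
          rw [Subgroup.mem_comap, map_mul, map_mul, mul_assoc, map_inv, ← QuotientGroup.eq, hσ,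
            ← smul_eq_mul, ← MulAction.Quotient.smul_coe, hσ, smul_inv_smul]
        have := φ.2 ⟨_, hmem⟩ (σ ((ι g)⁻¹ • y))⁻¹
        simpa using this }
  refine isZero_groupCohomology_of_retract i r ?_ n (h.of_iso (groupCohomology.coindIso A n))
  ext a y
  change a ((ι (σ y)⁻¹⁻¹ : Γ) : Γ ⧸ K) = a y
  rw [inv_inv, hσ]

end Comparison

/-! ### Conjugacy classes of subgroups and of elements -/

section ConjugacyClasses

variable {G : Type u} [Group G] {p : ℕ}

open scoped Pointwise in
theorem ConjAct.smul_zpowers (a : ConjAct G) (g : G) :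
    a • Subgroup.zpowers g = Subgroup.zpowers (a • g) :=
  MonoidHom.map_zpowers (MulDistribMulAction.toMonoidEnd (ConjAct G) G a) g

open scoped Pointwise in
theorem finite_elementClassesOfOrder (hp : p.Prime) (h : (subgroupClassesOfOrder G p).Finite) :
    (elementClassesOfOrder G p).Finite := by
  have hrep : ∀ c ∈ subgroupClassesOfOrder G p, ∃ P : Subgroup G, Nat.card P = p ∧
      Quotient.mk'' P = c := fun c ⟨P, hP, hPc⟩ => ⟨P, hP, hPc⟩
  choose! P hP hPc using hrep
  refine Set.Finite.subset (h.biUnion fun c hc => ?_ :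
    (⋃ c ∈ subgroupClassesOfOrder G p, ConjClasses.mk '' (P c : Set G)).Finite) ?_
  · have : Finite (P c) := Nat.finite_of_card_ne_zero (by rw [hP c hc]; exact hp.ne_zero)
    exact (Set.toFinite (P c : Set G)).image _
  · rintro _ ⟨g, hg, rfl⟩
    have hmem : (Quotient.mk'' (Subgroup.zpowers g) :
        MulAction.orbitRel.Quotient (ConjAct G) (Subgroup G)) ∈ subgroupClassesOfOrder G p :=
      ⟨_, (Nat.card_zpowers g).trans hg, rfl⟩
    refine Set.mem_biUnion hmem ?_
    obtain ⟨a, ha⟩ := MulAction.orbitRel_apply.1 (Quotient.eq''.1 (hPc _ hmem))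
    refine ⟨a • g, ?_, ?_⟩
    · change a • Subgroup.zpowers g = P _ at ha
      rw [← ha, ConjAct.smul_zpowers]
      exact Subgroup.mem_zpowers _
    · rw [ConjClasses.mk_eq_mk_iff_isConj, isConj_comm, isConj_iff]
      exact ⟨ConjAct.ofConjAct a, rfl⟩

open scoped Pointwise in
theorem finite_subgroupClassesOfOrder (hp : p.Prime) (h : (elementClassesOfOrder G p).Finite) :
    (subgroupClassesOfOrder G p).Finite := by
  have := Fact.mk hp
  refine (h.image fun c => (Quotient.mk'' (Subgroup.zpowers (Quotient.out c)) :
    MulAction.orbitRel.Quotient (ConjAct G) (Subgroup G))).subset ?_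
  rintro _ ⟨P, hP, rfl⟩
  have hP' : Nat.card P = p := hP
  have : Finite P := Nat.finite_of_card_ne_zero (by rw [hP']; exact hp.ne_zero)
  have : Nontrivial P := by
    rw [← Finite.one_lt_card_iff_nontrivial, hP']
    exact hp.one_lt
  obtain ⟨x, hx⟩ := exists_ne (1 : P)
  have hxP : Subgroup.zpowers (x : G) = P := by
    refine le_antisymm (by simp) fun y hy => ?_
    obtain ⟨n, hn⟩ := mem_zpowers_of_prime_card (g' := ⟨y, hy⟩) hP' hx
    exact ⟨n, congrArg Subtype.val hn⟩
  have hord : orderOf (x : G) = p := by rw [← Nat.card_zpowers, hxP, hP']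
  refine ⟨ConjClasses.mk (x : G), ⟨_, hord, rfl⟩, ?_⟩
  refine Quotient.eq''.2 (MulAction.orbitRel_apply.2 ?_)
  have hconj : IsConj (x : G) (Quotient.out (ConjClasses.mk (x : G))) :=
    ConjClasses.mk_eq_mk_iff_isConj.1 (Quotient.out_eq _).symm
  obtain ⟨a, ha⟩ := isConj_iff.1 hconj
  refine ⟨ConjAct.toConjAct a, ?_⟩
  have key := ConjAct.smul_zpowers (ConjAct.toConjAct a) (x : G)
  rw [hxP, ConjAct.toConjAct_smul, ha] at key
  exact key

end ConjugacyClasses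

/-! ### From cohomology to elements of order `p` -/

section FiniteDimension

variable {G : Type u} [Group G]

theorem exists_subgroup_of_vcd_lt_top (h : vcd G < ⊤) :
    ∃ U : Subgroup G, U.FiniteIndex ∧ (∀ u : U, IsOfFinOrder u → u = 1) ∧
      ∃ N, CohomologyVanishesFrom IntU.{u} U N := by
  by_contra! hcon
  refine h.ne (iInf_eq_top.2 fun U => iInf_eq_top.2 fun hU => iInf_eq_top.2 fun hU' => ?_)
  by_contra hne
  obtain ⟨N, hN⟩ := (projectiveDimension_ne_top_iff _).1 hne
  exact hcon U hU hU' _ (cohomologyVanishesFrom_of_hasProjectiveDimensionLT hN)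

theorem isClosed_setOf_isConj {Γ : Type*} [Group Γ] [TopologicalSpace Γ] [IsTopologicalGroup Γ]
    [CompactSpace Γ] [T2Space Γ] (a : Γ) : IsClosed {x | IsConj x a} := by
  have : {x | IsConj x a} = Set.range fun y : Γ => y * a * y⁻¹ := by
    ext x
    rw [Set.mem_ofPred_eq, isConj_comm, isConj_iff]
    rfl
  rw [this]
  exact (isCompact_range (by fun_prop)).isClosed

/-- Finiteness enters here: the set is a finite union of conjugacy classes, each closed because `Ĝ`
is compact. -/
theorem isClosed_setOf_isConj_toProfComp {p : ℕ} (h : (elementClassesOfOrder G p).Finite) :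
    IsClosed {x : ProfComp G | ∃ g : G, orderOf g = p ∧ IsConj x (toProfComp G g)} := by
  have : {x : ProfComp G | ∃ g : G, orderOf g = p ∧ IsConj x (toProfComp G g)} =
      ⋃ c ∈ elementClassesOfOrder G p, {x | IsConj x (toProfComp G (Quotient.out c))} := by
    have hout (g : G) : IsConj g (Quotient.out (ConjClasses.mk g)) :=
      ConjClasses.mk_eq_mk_iff_isConj.1 (Quotient.out_eq _).symm
    ext x
    simp only [Set.mem_ofPred_eq, Set.mem_iUnion, exists_prop]
    constructor
    · rintro ⟨g, hg, hx⟩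
      exact ⟨_, ⟨g, hg, rfl⟩, hx.trans ((toProfComp G).map_isConj (hout g))⟩
    · rintro ⟨_, ⟨g, hg, rfl⟩, hx⟩
      exact ⟨g, hg, hx.trans ((toProfComp G).map_isConj (hout g).symm)⟩
  rw [this]
  exact h.isClosed_biUnion fun c _ => isClosed_setOf_isConj _

theorem exists_toProfComp_mem {s : Set (ProfComp G)} (hs : IsOpen s) (hne : s.Nonempty) :
    ∃ g : G, toProfComp G g ∈ s :=
  (ProfiniteGrp.ProfiniteCompletion.denseRange (GrpCat.of G)).exists_mem_open hs hne

theorem exists_isOpen_toProfComp_mem (U : Subgroup G) [U.FiniteIndex] :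
    ∃ s : Set (ProfComp G), IsOpen s ∧ 1 ∈ s ∧ ∀ g : G, toProfComp G g ∈ s → g ∈ U := by
  let m : FiniteIndexNormalSubgroup (GrpCat.of G) := { toSubgroup := U.normalCore }
  have : DiscreteTopology ((ProfiniteGrp.ProfiniteCompletion.diagram (GrpCat.of G)).obj m) := ⟨rfl⟩
  refine ⟨{x | x.val m = 1}, ?_, rfl, fun g hg => ?_⟩
  · exact (isOpen_discrete {1}).preimage ((continuous_apply m).comp continuous_subtype_val)
  · exact U.normalCore_le ((QuotientGroup.eq_one_iff g).1 hg)


open Limits in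
theorem exists_orderOf_eq_of_isIso_contCohomologyRes {k Γ C : Type u} [CommRing k] [Group Γ]
    [TopologicalSpace Γ] [IsTopologicalGroup Γ] [CompactSpace Γ] [CommGroup C] {p N : ℕ}
    (hp : p.Prime) (ι : G →* Γ) {K : Subgroup Γ} (hK : IsOpen (K : Set Γ))
    (hι : ∀ x : Γ, ∃ g : G, (ι g : Γ ⧸ K) = x) {χ : K →* C} (hχ : IsLocallyConstant χ)
    (τ : C →* Γ) (hτ : ∀ c, τ c ∈ K) (hχτ : ∀ c, χ ⟨τ c, hτ c⟩ = c)
    (hχι : Function.Surjective (χ.comp (ι.subgroupComap K)))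
    (hN : CohomologyVanishesFrom k (χ.comp (ι.subgroupComap K)).ker N)
    (hC : Nat.card C = p) {c : C} (hc : ∀ x, x ∈ Subgroup.zpowers c)
    (W : Type u) [AddCommGroup W] [Module k W] [Nontrivial W] (hpW : ∀ w : W, p • w = 0)
    (hiso : ∀ n, IsIso (contCohomologyRes ι (functionRep k Γ (Γ ⧸ K) W)
      (isDiscreteModule_functionRep hK) n)) :
    ∃ h : K.comap ι, orderOf h = p := by
  by_contra! hcon
  have := Fact.mk hp
  have : Finite C := Nat.finite_of_card_ne_zero (by rw [hC]; exact hp.ne_zero)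
  have htf (h : K.comap ι) (hh : h ^ p = 1) : h = 1 := by
    by_contra hne
    exact hcon h (orderOf_eq_prime hh hne)
  obtain ⟨n₀, hn₀⟩ := exists_isZero_groupCohomology _ hp
    ((Nat.card_congr (QuotientGroup.quotientKerEquivOfSurjective _ hχι).toEquiv).trans hC) hN htf
    (Rep.trivial k (K.comap ι) W) fun w => (Nat.cast_smul_eq_nsmul k p w).trans (hpW w)
  -- The degree `2 * n₀ + 2` is positive, even and at least `n₀`.
  have hH := isZero_groupCohomology_res_functionRep ι K hι W _
    (hn₀ (2 * n₀ + 1 + 1) (by lia))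
  have := hiso (2 * n₀ + 1 + 1)
  exact not_isZero_groupCohomology_of_cyclic c hc (fun w => by rw [hC]; exact hpW w)
    (Nat.succ_ne_zero (2 * n₀ + 1)) ⟨n₀ + 1, by lia⟩
    (isZero_groupCohomology_of_isZero_contCohomology hK hχ τ hτ hχτ _
      (hH.of_iso (asIso (contCohomologyRes ι _ _ _))))

open scoped IsMulCommutative in
-- The subgroup generated by `γ` splits the projection onto the group generated by `π γ`. The
-- element of order `p` that cohomology provides has nontrivial image by `htf`, hence generates that
-- group, and a power of it lies above `π γ`.
theorem exists_orderOf_eq_map_eq {k Γ Q : Type u} [CommRing k] [Group Γ]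
    [TopologicalSpace Γ] [IsTopologicalGroup Γ] [CompactSpace Γ] [Group Q] {p N : ℕ}
    (hp : p.Prime) (ι : G →* Γ) {π : Γ →* Q} (hπ : IsLocallyConstant π)
    (hι : ∀ x : Γ, ∃ g : G, π (ι g) = π x) (hN : CohomologyVanishesFrom k (π.comp ι).ker N)
    (htf : ∀ g : G, orderOf g = p → π (ι g) ≠ 1)
    {γ : Γ} (hγ : orderOf γ = p) (hγπ : π γ ≠ 1)
    (W : Type u) [AddCommGroup W] [Module k W] [Nontrivial W] [Finite W]
    (hpW : ∀ w : W, p • w = 0)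
    (hiso : ∀ (M : Rep.{u} k Γ) (hM : IsDiscreteModule M), Finite M →
      ∀ n : ℕ, IsIso (contCohomologyRes ι M hM n)) :
    ∃ g : G, orderOf g = p ∧ π (ι g) = π γ := by
  have := Fact.mk hp
  have hord : orderOf (π γ) = p :=
    orderOf_eq_prime (by rw [← map_pow, ← hγ, pow_orderOf_eq_one, map_one]) hγπ
  have hC : Nat.card (Subgroup.zpowers (π γ)) = p := (Nat.card_zpowers _).trans hord
  have hcard : Nat.card (Subgroup.zpowers γ) = p := (Nat.card_zpowers γ).trans hγ
  have : Finite (Subgroup.zpowers γ) :=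
    Nat.finite_of_card_ne_zero (by rw [hcard]; exact hp.ne_zero)
  let q : Subgroup.zpowers γ →* Subgroup.zpowers (π γ) :=
    (π.comp (Subgroup.zpowers γ).subtype).codRestrict _ (by
      rintro ⟨_, n, rfl⟩
      exact ⟨n, (map_zpow π γ n).symm⟩)
  have hq : Function.Surjective q := by
    rintro ⟨_, n, rfl⟩
    exact ⟨⟨_, n, rfl⟩, Subtype.ext (map_zpow π γ n)⟩
  let e := MulEquiv.ofBijective q (hq.bijective_of_nat_card_le (by rw [hcard, hC]))
  let τ : Subgroup.zpowers (π γ) →* Γ := (Subgroup.zpowers γ).subtype.comp e.symm.toMonoidHom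
  have hτ (c : Subgroup.zpowers (π γ)) : π (τ c) = c :=
    congrArg Subtype.val (e.apply_symm_apply c)
  have hK : IsOpen ((Subgroup.zpowers (π γ)).comap π : Set Γ) := hπ (Subgroup.zpowers (π γ) : Set Q)
  have : Finite (Γ ⧸ (Subgroup.zpowers (π γ)).comap π) := Subgroup.quotient_finite_of_isOpen _ hK
  obtain ⟨h, hh⟩ := exists_orderOf_eq_of_isIso_contCohomologyRes (k := k) (N := N)
    (χ := π.subgroupComap (Subgroup.zpowers (π γ))) hp ι hK
    (fun x => by
      obtain ⟨g, hg⟩ := hι x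
      refine ⟨g, QuotientGroup.eq.2 ?_⟩
      rw [Subgroup.mem_comap, map_mul, map_inv, hg, inv_mul_cancel]
      exact Subgroup.one_mem _)
    (.desc _ Subtype.val (hπ.comp_continuous continuous_subtype_val) Subtype.val_injective)
    τ (fun c => Subgroup.mem_comap.2 (by rw [hτ]; exact c.2)) (fun c => Subtype.ext (hτ c))
    (fun c => by
      obtain ⟨g, hg⟩ := hι (τ c)
      rw [hτ] at hg
      exact ⟨⟨g, by simp [hg]⟩, Subtype.ext hg⟩)
    (hN.of_injective (((Subgroup.subtype _).comp (Subgroup.subtype _)).codRestrict _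
        fun u => congrArg Subtype.val u.2)
      fun a b hab => Subtype.ext (Subtype.ext (congrArg Subtype.val hab :)))
    hC (c := ⟨π γ, Subgroup.mem_zpowers _⟩) (by
      rintro ⟨_, n, rfl⟩
      exact ⟨n, rfl⟩)
    W hpW
    (hiso _ _ (Pi.finite : Finite (Γ ⧸ (Subgroup.zpowers (π γ)).comap π → W)))
  have hh' : orderOf (h : G) = p := (Subgroup.orderOf_coe h).trans hh
  obtain ⟨b, hb⟩ := mem_zpowers_of_prime_card (g := (⟨π (ι h), h.2⟩ : Subgroup.zpowers (π γ)))
    (g' := ⟨π γ, Subgroup.mem_zpowers _⟩) hC fun h1 => htf h hh' (congrArg Subtype.val h1)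
  have hb' : π (ι ((h : G) ^ b)) = π γ := by
    rw [map_zpow, map_zpow]
    exact congrArg Subtype.val hb
  refine ⟨(h : G) ^ b, orderOf_eq_prime ?_ fun h1 => hγπ ?_, hb'⟩
  · rw [← zpow_natCast, zpow_comm, zpow_natCast, ← hh', pow_orderOf_eq_one, one_zpow]
  · rw [← hb', h1, map_one, map_one]

theorem exists_isConj_toProfComp {p : ℕ} (hp : p.Prime) (hgood : IsCohomologicallyGood G)
    (hvcd : vcd G < ⊤) (hfin : (elementClassesOfOrder G p).Finite) {γ : ProfComp G}
    (hγ : orderOf γ = p) : ∃ g : G, IsConj γ (toProfComp G g) := by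
  by_contra! hcon
  have := Fact.mk hp
  obtain ⟨U, hU, htf, N, hN⟩ := exists_subgroup_of_vcd_lt_top hvcd
  obtain ⟨s, hs, hs1, hsU⟩ := exists_isOpen_toProfComp_mem U
  -- Adjoining `1` to the set that `γV` must avoid ensures that `γ` has nontrivial image modulo `V`.
  have hclosed := (isClosed_setOf_isConj_toProfComp hfin).union
    (isClosed_singleton (x := (1 : ProfComp G)))
  have hγ1 : γ ≠ 1 := by
    rintro rfl
    exact hp.one_lt.ne (orderOf_one.symm.trans hγ)
  obtain ⟨V, hV⟩ := ProfiniteGrp.exist_openNormalSubgroup_sub_open_nhds_of_one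
    (hs.inter (hclosed.isOpen_compl.preimage (continuous_const_mul γ))) ⟨hs1, by
      rw [Set.mem_preimage, mul_one]
      rintro (⟨g, -, hg⟩ | h)
      exacts [hcon g hg, hγ1 h]⟩
  have hπ : IsLocallyConstant (QuotientGroup.mk' V.toSubgroup) :=
    have : DiscreteTopology (ProfComp G ⧸ V.toSubgroup) :=
      QuotientGroup.discreteTopology V.isOpen'
    (IsLocallyConstant.iff_continuous _).2 QuotientGroup.continuous_mk
  have hγV : QuotientGroup.mk' V.toSubgroup γ ≠ 1 := fun h =>
    (hV (V.inv_mem ((QuotientGroup.eq_one_iff γ).1 h))).2 (Or.inr (mul_inv_cancel γ))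
  have hVU : ((QuotientGroup.mk' V.toSubgroup).comp (toProfComp G)).ker ≤ U :=
    fun g hg => hsU g (hV ((QuotientGroup.eq_one_iff (toProfComp G g)).1 hg)).1
  let _ : Module IntU.{u} (ULift.{u} (ZMod p)) :=
    Module.compHom _ (ULift.ringEquiv : ULift.{u} ℤ ≃+* ℤ).toRingHom
  obtain ⟨g, hg, hgγ⟩ := exists_orderOf_eq_map_eq hp (toProfComp G) hπ
    (fun x => exists_toProfComp_mem (hπ.isOpen_fiber _) ⟨x, rfl⟩)
    (hN.of_injective (Subgroup.inclusion hVU) (Subgroup.inclusion_injective hVU))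
    (fun g hg h => by
      have h1 : g = 1 := congrArg Subtype.val (htf ⟨g, hVU h⟩
        (Submonoid.isOfFinOrder_coe.1 (orderOf_pos_iff.1 (hg ▸ hp.pos))))
      exact hp.one_lt.ne (by rw [← hg, h1, orderOf_one]))
    hγ hγV (ULift.{u} (ZMod p)) (fun w => ULift.ext _ _ (by simp)) hgood
  refine (hV (QuotientGroup.eq.1 hgγ.symm)).2 (Or.inl ⟨g, hg, ?_⟩)
  simp only [mul_inv_cancel_left, IsConj.refl]

end FiniteDimension

end

theorem proposition3p4 (p : ℕ) (hp : p.Prime) (G : Type u) [Group G]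
    (hres : Group.ResiduallyFinite G) (hgood : IsCohomologicallyGood G) (hvcd : vcd G < ⊤) :
    ((subgroupClassesOfOrder G p).Finite ↔ (elementClassesOfOrder G p).Finite) ∧
      ((subgroupClassesOfOrder G p).Finite →
        ∀ γ : ProfComp G, orderOf γ = p → ∃ g : G, IsConj γ (toProfComp G g)) := by
  exact ⟨⟨finite_elementClassesOfOrder hp, finite_subgroupClassesOfOrder hp⟩, fun h _ hγ =>
    exists_isConj_toProfComp hp hgood hvcd (finite_elementClassesOfOrder hp h) hγ⟩
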